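/- Let $H\in(0,1)$. A one-dimensional fractional Brownian motion (fBm) with Hurst parameter $H$ is a centered Gaussian process $B=(B_t)_{t\ge 0}$ on a probability space $(\Omega,\mathcal F,\mathbb P)$ with almost surely continuous paths and covariance $\mathbb E[B_sB_t]=\tfrac12\left(t^{2H}+s^{2H}-|t-s|^{2H}\right)$. For $T>0$ and $\beta>0$ put $$L_T(y)=\left|\{t\in[0,T]:|B_t-y|<1\}\right|,\qquad \mathcal E_T=\exp\Big(-\beta\int_{\mathbb R}L_T(z)^2\,dz\Big),\qquad Z_T=\mathbb E[\mathcal E_T],\qquad \mathbb Q_T(A)=\frac1{Z_T}\mathbb E[\mathbf 1_A\mathcal E_T],$$ where $|S|$ is the Lebesgue measure of $S$, and let $$R_T=\Big[\frac1T\int_0^T|B_t-\overline B_T|^2\,dt\Big]^{1/2},\qquad \overline B_T=\frac1T\int_0^TB_t\,dt .$$ **Theorem.** For every $H\in(0,1)$ there are constants $C_*,C^*,C,C'>0$, depending only on $H$, with $$C_*=\frac{9/128}{2C},\qquad C^*=\Big(\frac{2C}{C'}\Big)^{1/2},$$ such that for every one-dimensional fBm $B$ with Hurst parameter $H$ the following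 holds. (a) For all $\beta>0$, $T>0$ and $r\ge T^H$: $\ \mathbb E\left[\mathbf 1_{\{R_T\ge r\}}\mathcal E_T\right]\le\exp\left(-C'\,r^2/T^{2H}\right)$. (b) For every $\beta>0$ there is $T_\beta\ge e$, depending only on $\beta$ and $H$, such that for all $T\ge T_\beta$ $$\log Z_T\ge -C\,\beta^{2/3}T^{\frac{2(2-H)}3}$$ and $$\mathbb Q_T\left(C_*\beta^{1/3}T^{\frac{2(1+H)}3}\le R_T\le C^*\beta^{1/3}T^{\frac{2(1+H)}3}\right)\ge 1-2\exp\left(-C\,\beta^{2/3}T^{\frac{2(2-H)}3}\right).$$ -/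

import Mathlib

open MeasureTheory ProbabilityTheory
open scoped NNReal

universe u

noncomputable section

namespace SelfRepellent

/-- `B` is a one-dimensional fractional Brownian motion with Hurst parameter `H` on `(Ω, P)`:
a centered Gaussian process indexed by `[0, ∞)` with the covariance
`E[B_s B_t] = (t^{2H} + s^{2H} - |t - s|^{2H}) / 2` and almost surely continuous paths. -/
structure IsFBM {Ω : Type*} [MeasurableSpace Ω] (H : ℝ) (B : ℝ≥0 → Ω → ℝ) (P : Measure Ω) :
    Prop where
  isGaussianProcess : IsGaussianProcess B P
  mean_zero : ∀ t, ∫ ω, B t ω ∂P = 0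
  covariance : ∀ s t : ℝ≥0, ∫ ω, B s ω * B t ω ∂P =
    ((t : ℝ) ^ (2 * H) + (s : ℝ) ^ (2 * H) - |(t : ℝ) - (s : ℝ)| ^ (2 * H)) / 2
  continuous_paths : ∀ᵐ ω ∂P, Continuous fun t => B t ω

variable {Ω : Type*}

/-- Occupation time `L_T(y)`: the Lebesgue measure of the set of times `t ∈ [0, T]` at which the
path is in the open ball of radius `1` centered at `y`. -/
def occupationTime (B : ℝ≥0 → Ω → ℝ) (T : ℝ) (ω : Ω) (y : ℝ) : ℝ :=
  volume.real {t : ℝ | t ∈ Set.Icc 0 T ∧ B t.toNNReal ω ∈ Metric.ball y 1}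

/-- The weight `E_T = exp (-β ∫ L_T(z)² dz)`. -/
def weight (β : ℝ) (B : ℝ≥0 → Ω → ℝ) (T : ℝ) (ω : Ω) : ℝ :=
  Real.exp (-β * ∫ z : ℝ, occupationTime B T ω z ^ 2)

/-- The time average of the path over `[0, T]`. -/
def timeAverage (B : ℝ≥0 → Ω → ℝ) (T : ℝ) (ω : Ω) : ℝ :=
  (1 / T) * ∫ t in (0 : ℝ)..T, B t.toNNReal ω

/-- The radius of gyration `R_T`. -/
def radius (B : ℝ≥0 → Ω → ℝ) (T : ℝ) (ω : Ω) : ℝ :=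
  Real.sqrt ((1 / T) * ∫ t in (0 : ℝ)..T, |B t.toNNReal ω - timeAverage B T ω| ^ 2)

variable [MeasurableSpace Ω]

/-- The normalizing constant `Z_T = E[E_T]`. -/
def partitionFunction (β : ℝ) (B : ℝ≥0 → Ω → ℝ) (P : Measure Ω) (T : ℝ) : ℝ :=
  ∫ ω, weight β B T ω ∂P

/-- The measure `Q_T(A) = E[1_A E_T] / Z_T`. -/
def selfRepellentMeasure (β : ℝ) (B : ℝ≥0 → Ω → ℝ) (P : Measure Ω) (T : ℝ) : Measure Ω :=
  P.withDensity fun ω => ENNReal.ofReal (weight β B T ω / partitionFunction β B P T)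

end SelfRepellent

end

/-! ### Continuous modification and measurability -/

namespace SelfRepellent

open Filter Topology

variable {Ω : Type*} [MeasurableSpace Ω] {P : Measure Ω} {H : ℝ} {B B' : ℝ≥0 → Ω → ℝ}

/-! Write `X = β^(2/3) T^(2(2-H)/3)`. The proof compares a lower bound `Z_T ≥ exp(-C X)` with upper
bounds `exp(-2 C X)` for the weight carried by paths whose radius is too small or too large.
Dividing either tail by `Z_T` leaves at most `exp(-C X)`, and two tails give the factor 2.

Lower bound (`exp_le_partitionFunction`): tilt the law by `exp(λ B_T)`. By Cameron–Martin, an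
increment over a time `u` keeps its variance `u^(2H)` but acquires a mean at least `v u`, with `v`
of order `λ T^(2H-1)`. From any given time the path therefore spends expected time `O(1/v)` within
distance 2 of its position, and the expected self-intersection is `O(T/v)`. Jensen's inequality
bounds `log Z_T` below by minus this energy (times `β`) minus the entropy `λ² T^(2H)/2`. Balancing
the two in `λ` gives order `X`.

Small radius (`le_integral_occ_sq`): a path within `ρ` of its mean in quadratic mean spends, by
Chebyshev, most of its time in an interval of length of order `ρ`. Cauchy–Schwarz forces `∫ L²` to
be at least of order `T²/ρ`. At `ρ` of order `β^(1/3) T^(2(1+H)/3)` this costs a multiple of `X`.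

Large radius (`measure_le_radius_le`): the weight is at most 1, so the Gaussian tail of the radius
suffices. It comes from an exponential moment of `R_T²`, bounded by Jensen in time.

All quantities are insensitive to null sets, so the paths may be taken continuous everywhere, which
makes every functional measurable. -/

/-- A fractional Brownian motion all of whose coordinates are measurable and all of whose paths
are continuous. -/
structure IsRegularFBM (H : ℝ) (B : ℝ≥0 → Ω → ℝ) (P : Measure Ω) : Prop
    extends IsFBM H B P where
  measurable_coord : ∀ t, Measurable (B t)
  continuous_path : ∀ ω, Continuous fun t => B t ω

lemma IsFBM.congr (hB : IsFBM H B P) (h : ∀ᵐ ω ∂P, ∀ t, B t ω = B' t ω) : IsFBM H B' P where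
  isGaussianProcess := hB.isGaussianProcess.congr fun t => h.mono fun _ hω => hω t
  mean_zero t := by
    rw [← hB.mean_zero t]
    exact integral_congr_ae (h.mono fun ω hω => (hω t).symm)
  covariance s t := by
    rw [← hB.covariance s t]
    exact integral_congr_ae (h.mono fun ω hω => by simp only [hω])
  continuous_paths := by
    filter_upwards [h, hB.continuous_paths] with ω hω hc
    simpa only [hω] using hc

/-- Almost surely continuous paths can be made continuous everywhere, with measurable
coordinates. -/
lemma exists_regular_modification {X : ℝ≥0 → Ω → ℝ} (hm : ∀ t, AEMeasurable (X t) P)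
    (hc : ∀ᵐ ω ∂P, Continuous fun t => X t ω) :
    ∃ Y : ℝ≥0 → Ω → ℝ, (∀ t, Measurable (Y t)) ∧ (∀ ω, Continuous fun t => Y t ω) ∧
      ∀ᵐ ω ∂P, ∀ t, X t ω = Y t ω := by
  classical
  let d : ℕ → ℝ≥0 := TopologicalSpace.denseSeq ℝ≥0
  have hd : DenseRange d := TopologicalSpace.denseRange_denseSeq ℝ≥0
  have hgood : ∀ᵐ ω ∂P, (Continuous fun t => X t ω) ∧
      ∀ n, X (d n) ω = (hm (d n)).mk (X (d n)) ω :=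
    hc.and (ae_all_iff.2 fun n => (hm (d n)).ae_eq_mk)
  -- The exceptional set need not be measurable. Enlarging it to a measurable null set lets the
  -- paths be set to zero there without losing measurability.
  obtain ⟨N, hN, hNmeas, hNzero⟩ := exists_measurable_superset_of_null (ae_iff.1 hgood)
  have hgoodN : ∀ ω, ω ∉ N → (Continuous fun t => X t ω) ∧
      ∀ n, X (d n) ω = (hm (d n)).mk (X (d n)) ω := fun ω hω => by
    by_contra h
    exact hω (hN h)
  let Y : ℝ≥0 → Ω → ℝ := fun t ω => if ω ∈ N then 0 else X t ω
  have hYc : ∀ ω, Continuous fun t => Y t ω := fun ω => by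
    by_cases hω : ω ∈ N
    · simpa [Y, hω] using continuous_const
    · simpa [Y, hω] using (hgoodN ω hω).1
  have hYd : ∀ n, Measurable (Y (d n)) := fun n => by
    have : Y (d n) = fun ω => if ω ∈ N then 0 else (hm (d n)).mk (X (d n)) ω := by
      ext ω
      by_cases hω : ω ∈ N
      · simp [Y, hω]
      · simp [Y, hω, (hgoodN ω hω).2 n]
    rw [this]
    exact Measurable.ite hNmeas measurable_const (hm (d n)).measurable_mk
  refine ⟨Y, fun t => ?_, hYc, ?_⟩
  -- At a general time the coordinate is, by path continuity, a pointwise limit of coordinates at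
  -- times of the dense sequence.
  · obtain ⟨x, hx, hxt⟩ := mem_closure_iff_seq_limit.1 (hd t)
    refine measurable_of_tendsto_metrizable (f := fun n => Y (x n)) (fun n => ?_)
      (tendsto_pi_nhds.2 fun ω => ((hYc ω).tendsto t).comp hxt)
    obtain ⟨k, hk⟩ := hx n
    rw [← hk]
    exact hYd k
  · have : ∀ᵐ ω ∂P, ω ∉ N := measure_eq_zero_iff_ae_notMem.1 hNzero
    filter_upwards [this] with ω hω t
    simp [Y, hω]

lemma IsFBM.exists_regular (hB : IsFBM H B P) :
    ∃ B' : ℝ≥0 → Ω → ℝ, IsRegularFBM H B' P ∧ ∀ᵐ ω ∂P, ∀ t, B t ω = B' t ω := by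
  obtain ⟨Y, hYm, hYc, hXY⟩ :=
    exists_regular_modification hB.isGaussianProcess.aemeasurable hB.continuous_paths
  exact ⟨Y, { hB.congr hXY with measurable_coord := hYm, continuous_path := hYc }, hXY⟩

omit [MeasurableSpace Ω] in
lemma occupationTime_congr {ω : Ω} (h : ∀ t, B t ω = B' t ω) (T y : ℝ) :
    occupationTime B T ω y = occupationTime B' T ω y := by
  simp only [occupationTime, h]

omit [MeasurableSpace Ω] in
lemma weight_congr {ω : Ω} (h : ∀ t, B t ω = B' t ω) (β T : ℝ) :
    weight β B T ω = weight β B' T ω := by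
  simp only [weight, occupationTime_congr h]

omit [MeasurableSpace Ω] in
lemma radius_congr {ω : Ω} (h : ∀ t, B t ω = B' t ω) (T : ℝ) :
    radius B T ω = radius B' T ω := by
  simp only [radius, timeAverage, h]

namespace IsRegularFBM

variable (hB : IsRegularFBM H B P)
include hB

lemma continuous_real_path (ω : Ω) : Continuous fun t : ℝ => B t.toNNReal ω :=
  (hB.continuous_path ω).comp continuous_real_toNNReal

lemma measurable_uncurry : Measurable fun p : Ω × ℝ => B p.2.toNNReal p.1 := by
  have := measurable_uncurry_of_continuous_of_measurable (u := B) hB.continuous_path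
    hB.measurable_coord
  exact this.comp (measurable_snd.real_toNNReal.prodMk measurable_fst)

lemma measurableSet_occupation (T : ℝ) : MeasurableSet {p : (Ω × ℝ) × ℝ |
    p.2 ∈ Set.Icc 0 T ∧ B p.2.toNNReal p.1.1 ∈ Metric.ball p.1.2 1} := by
  have h1 : Measurable fun p : (Ω × ℝ) × ℝ => B p.2.toNNReal p.1.1 :=
    hB.measurable_uncurry.comp ((measurable_fst.comp measurable_fst).prodMk measurable_snd)
  refine (measurable_snd measurableSet_Icc).inter ?_
  exact measurableSet_lt (h1.dist (measurable_snd.comp measurable_fst)) measurable_const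

lemma measurable_occupationTime (T : ℝ) :
    Measurable fun p : Ω × ℝ => occupationTime B T p.1 p.2 :=
  (measurable_measure_prodMk_left (hB.measurableSet_occupation T)).ennreal_toReal

lemma measurable_selfIntersection (T : ℝ) :
    Measurable fun ω => ∫ z : ℝ, occupationTime B T ω z ^ 2 :=
  ((hB.measurable_occupationTime T).pow_const 2).stronglyMeasurable.integral_prod_right'.measurable

lemma measurable_weight (β T : ℝ) : Measurable (weight β B T) :=
  ((hB.measurable_selfIntersection T).const_mul (-β)).exp

lemma measurable_timeAverage (T : ℝ) : Measurable (timeAverage B T) := by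
  unfold timeAverage
  refine Measurable.const_mul ?_ _
  simp only [intervalIntegral]
  exact (hB.measurable_uncurry.stronglyMeasurable.integral_prod_right'.measurable).sub
    (hB.measurable_uncurry.stronglyMeasurable.integral_prod_right'.measurable)

lemma measurable_radius (T : ℝ) : Measurable (radius B T) := by
  unfold radius
  refine (Measurable.const_mul ?_ _).sqrt
  have h : Measurable fun p : Ω × ℝ => |B p.2.toNNReal p.1 - timeAverage B T p.1| ^ 2 := by
    have : Measurable fun p : Ω × ℝ => (B p.2.toNNReal p.1 - timeAverage B T p.1) ^ 2 :=
      (hB.measurable_uncurry.sub ((hB.measurable_timeAverage T).comp measurable_fst)).pow_const 2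
    simpa only [sq_abs] using this
  simp only [intervalIntegral]
  exact (h.stronglyMeasurable.integral_prod_right'.measurable).sub
    (h.stronglyMeasurable.integral_prod_right'.measurable)

end IsRegularFBM

end SelfRepellent

/-! ### Deterministic bounds on occupation times of a continuous path -/

namespace SelfRepellent

open scoped ENNReal

/-- The occupation measure of the unit ball around `z` of a path `f` on `[0, T]`. -/
noncomputable def occ (f : ℝ → ℝ) (T z : ℝ) : ℝ≥0∞ :=
  volume {t : ℝ | t ∈ Set.Icc 0 T ∧ f t ∈ Metric.ball z 1}

variable {f : ℝ → ℝ} {T : ℝ}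

lemma occ_le (f : ℝ → ℝ) (T z : ℝ) : occ f T z ≤ ENNReal.ofReal T := by
  refine (measure_mono (t := Set.Icc 0 T) fun t ht => ht.1).trans ?_
  simp

lemma occ_ne_top (f : ℝ → ℝ) (T z : ℝ) : occ f T z ≠ ∞ :=
  ((occ_le f T z).trans_lt ENNReal.ofReal_lt_top).ne

lemma measurable_occ (hf : Continuous f) (T : ℝ) : Measurable (occ f T) := by
  have : MeasurableSet {p : ℝ × ℝ | p.2 ∈ Set.Icc 0 T ∧ f p.2 ∈ Metric.ball p.1 1} := by
    refine (measurable_snd measurableSet_Icc).inter ?_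
    exact measurableSet_lt ((hf.measurable.comp measurable_snd).dist measurable_fst)
      measurable_const
  exact measurable_measure_prodMk_left this

lemma occ_eq_lintegral (hf : Continuous f) (T z : ℝ) :
    occ f T z = ∫⁻ t in Set.Icc 0 T, (Metric.ball (f t) 1).indicator 1 z := by
  have hm : MeasurableSet {t : ℝ | f t ∈ Metric.ball z 1} := hf.measurable measurableSet_ball
  have : (fun t => (Metric.ball (f t) 1).indicator (1 : ℝ → ℝ≥0∞) z) =
      {t : ℝ | f t ∈ Metric.ball z 1}.indicator 1 := by
    ext t
    by_cases h : f t ∈ Metric.ball z 1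
    · rw [Set.indicator_of_mem (Metric.mem_ball_comm.1 h), Set.indicator_of_mem (by exact h)]
      rfl
    · rw [Set.indicator_of_notMem (fun h' => h (Metric.mem_ball_comm.1 h')),
        Set.indicator_of_notMem (by exact h)]
  rw [this, lintegral_indicator_one hm, Measure.restrict_apply hm, occ]
  congr 1
  ext t
  simp [and_comm]

lemma measurable_ball_indicator (hf : Continuous f) :
    Measurable fun p : ℝ × ℝ => (Metric.ball (f p.1) 1).indicator (1 : ℝ → ℝ≥0∞) p.2 := by
  have hm : MeasurableSet {p : ℝ × ℝ | p.2 ∈ Metric.ball (f p.1) 1} :=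
    measurableSet_lt (measurable_snd.dist (hf.measurable.comp measurable_fst)) measurable_const
  exact measurable_one.indicator hm

lemma setLIntegral_occ (hf : Continuous f) (T : ℝ) {s : Set ℝ} :
    ∫⁻ z in s, occ f T z = ∫⁻ t in Set.Icc 0 T, volume (Metric.ball (f t) 1 ∩ s) := by
  simp only [occ_eq_lintegral hf]
  rw [lintegral_lintegral_swap (f := fun z t => (Metric.ball (f t) 1).indicator 1 z)
    ((measurable_ball_indicator hf).comp measurable_swap).aemeasurable]
  refine lintegral_congr fun t => ?_
  rw [lintegral_indicator_one measurableSet_ball, Measure.restrict_apply measurableSet_ball]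

lemma lintegral_occ (hf : Continuous f) (T : ℝ) :
    ∫⁻ z, occ f T z = 2 * ENNReal.ofReal T := by
  have := setLIntegral_occ hf T (s := Set.univ)
  simp only [Measure.restrict_univ, Set.inter_univ, Real.volume_ball, lintegral_const] at this
  rw [this]
  simp

lemma integrable_occ (hf : Continuous f) (T : ℝ) : Integrable fun z => (occ f T z).toReal :=
  integrable_toReal_of_lintegral_ne_top (measurable_occ hf T).aemeasurable
    (by rw [lintegral_occ hf]; finiteness)

lemma toReal_occ_le (hT : 0 ≤ T) (z : ℝ) : (occ f T z).toReal ≤ T :=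
  ENNReal.toReal_le_of_le_ofReal hT (occ_le f T z)

lemma integrable_occ_sq (hf : Continuous f) (hT : 0 ≤ T) :
    Integrable fun z => (occ f T z).toReal ^ 2 := by
  refine ((integrable_occ hf T).const_mul T).mono'
    ((measurable_occ hf T).ennreal_toReal.pow_const 2).aestronglyMeasurable
    (Filter.Eventually.of_forall fun z => ?_)
  rw [Real.norm_of_nonneg (by positivity), sq]
  exact mul_le_mul_of_nonneg_right (toReal_occ_le hT z) ENNReal.toReal_nonneg

/-- The self-intersection functional is at most twice the measure of the pairs of times at which
the path takes values at distance less than `2`. -/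
lemma lintegral_occ_sq_le (hf : Continuous f) (T : ℝ) :
    ∫⁻ z, occ f T z ^ 2 ≤ ∫⁻ s in Set.Icc 0 T, ∫⁻ t in Set.Icc 0 T,
      2 * {p : ℝ × ℝ | |f p.1 - f p.2| < 2}.indicator 1 (s, t) := by
  have hk := measurable_ball_indicator hf
  have h1 : ∀ z, occ f T z ^ 2 = ∫⁻ s in Set.Icc 0 T, ∫⁻ t in Set.Icc 0 T,
      (Metric.ball (f s) 1).indicator (1 : ℝ → ℝ≥0∞) z *
        (Metric.ball (f t) 1).indicator (1 : ℝ → ℝ≥0∞) z := fun z => by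
    have hz : Measurable fun t => (Metric.ball (f t) 1).indicator (1 : ℝ → ℝ≥0∞) z :=
      hk.comp (measurable_id.prodMk measurable_const)
    simp_rw [lintegral_const_mul _ hz]
    rw [lintegral_mul_const _ hz, ← occ_eq_lintegral hf, sq]
  have h2 : ∀ s, Measurable fun p : ℝ × ℝ => (Metric.ball (f s) 1).indicator (1 : ℝ → ℝ≥0∞) p.1 *
      (Metric.ball (f p.2) 1).indicator (1 : ℝ → ℝ≥0∞) p.1 := fun s =>
    (hk.comp (measurable_const.prodMk measurable_fst)).mul (hk.comp measurable_swap)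
  have h3 : Measurable fun p : (ℝ × ℝ) × ℝ =>
      (Metric.ball (f p.1.2) 1).indicator (1 : ℝ → ℝ≥0∞) p.1.1 *
      (Metric.ball (f p.2) 1).indicator (1 : ℝ → ℝ≥0∞) p.1.1 :=
    (hk.comp ((measurable_snd.comp measurable_fst).prodMk (measurable_fst.comp measurable_fst))).mul
      (hk.comp (measurable_snd.prodMk (measurable_fst.comp measurable_fst)))
  simp_rw [h1]
  rw [lintegral_lintegral_swap (Measurable.aemeasurable h3.lintegral_prod_right')]
  refine lintegral_mono fun s => ?_
  rw [lintegral_lintegral_swap (h2 s).aemeasurable]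
  refine lintegral_mono fun t => ?_
  -- Unit balls around `f s` and `f t` meet only if the centers are closer than 2, and their overlap
  -- then has length at most 2.
  by_cases hst : |f s - f t| < 2
  · rw [Set.indicator_of_mem (by exact hst)]
    calc ∫⁻ z, (Metric.ball (f s) 1).indicator (1 : ℝ → ℝ≥0∞) z *
          (Metric.ball (f t) 1).indicator (1 : ℝ → ℝ≥0∞) z
        ≤ ∫⁻ z, (Metric.ball (f s) 1).indicator (1 : ℝ → ℝ≥0∞) z := by
          refine lintegral_mono fun z => mul_le_of_le_one_right' ?_
          exact Set.indicator_le_self _ _ _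
      _ = 2 * 1 := by
          rw [lintegral_indicator_one measurableSet_ball, Real.volume_ball]; simp
  · rw [Set.indicator_of_notMem (by exact hst)]
    have : ∀ z, (Metric.ball (f s) 1).indicator (1 : ℝ → ℝ≥0∞) z *
          (Metric.ball (f t) 1).indicator (1 : ℝ → ℝ≥0∞) z = 0 := fun z => by
      by_contra hne
      have hs : z ∈ Metric.ball (f s) 1 := by
        by_contra h; exact hne (by rw [Set.indicator_of_notMem h, zero_mul])
      have ht : z ∈ Metric.ball (f t) 1 := by
        by_contra h; exact hne (by rw [Set.indicator_of_notMem h, mul_zero])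
      rw [Metric.mem_ball, Real.dist_eq, abs_lt] at hs ht
      exact hst (abs_lt.2 ⟨by linarith, by linarith⟩)
    simp [this]

/-- A path that stays within `ρ` of `m` in quadratic mean has a large self-intersection
functional. -/
lemma le_integral_occ_sq (hf : Continuous f) (hT : 0 < T) {m ρ : ℝ} (hρ : 1 ≤ ρ)
    (h : ∫ t in (0 : ℝ)..T, (f t - m) ^ 2 ≤ T * ρ ^ 2) :
    3 * T ^ 2 / (8 * ρ) ≤ ∫ z, (occ f T z).toReal ^ 2 := by
  have hρ0 : 0 < ρ := by linarith
  set I : Set ℝ := Metric.ball m (2 * ρ + 1) with hI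
  -- Chebyshev in integrated form: `g` is at most 2 where `|f t - m| ≤ 2ρ` and nonpositive
  -- elsewhere, while its integral is at least `2 (T - T/4)`. The interval `I` is wide enough to
  -- contain the whole unit ball around each such `f t`.
  set g : ℝ → ℝ := fun t => 2 * (1 - (f t - m) ^ 2 / (4 * ρ ^ 2)) with hg
  have hgc : Continuous g := by fun_prop
  have hgI : 3 * T / 2 ≤ ∫ t in Set.Icc 0 T, g t := by
    rw [integral_Icc_eq_integral_Ioc, ← intervalIntegral.integral_of_le hT.le]
    have e : ∫ t in (0 : ℝ)..T, g t =
        2 * (T - (∫ t in (0 : ℝ)..T, (f t - m) ^ 2) / (4 * ρ ^ 2)) := by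
      rw [hg, intervalIntegral.integral_const_mul, intervalIntegral.integral_sub,
        intervalIntegral.integral_div]
      · simp
      · simp
      · exact Continuous.intervalIntegrable (by fun_prop) _ _
    have : (∫ t in (0 : ℝ)..T, (f t - m) ^ 2) / (4 * ρ ^ 2) ≤ T / 4 := by
      rw [div_le_div_iff₀ (by positivity) (by norm_num)]
      nlinarith
    rw [e]
    linarith
  have hlow : ENNReal.ofReal (3 * T / 2) ≤ ∫⁻ z in I, occ f T z := by
    rw [setLIntegral_occ hf]
    calc ENNReal.ofReal (3 * T / 2) ≤ ENNReal.ofReal (∫ t in Set.Icc 0 T, g t) :=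
          ENNReal.ofReal_le_ofReal hgI
      _ ≤ ∫⁻ t in Set.Icc 0 T, ENNReal.ofReal (g t) := by
          rw [integral_eq_lintegral_pos_part_sub_lintegral_neg_part
            hgc.integrableOn_Icc]
          refine (ENNReal.ofReal_le_ofReal (sub_le_self _ ENNReal.toReal_nonneg)).trans ?_
          exact ENNReal.ofReal_toReal_le
      _ ≤ ∫⁻ t in Set.Icc 0 T, volume (Metric.ball (f t) 1 ∩ I) := by
          refine lintegral_mono fun t => ?_
          by_cases ht : |f t - m| ≤ 2 * ρ
          · have hsub : Metric.ball (f t) 1 ⊆ I := by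
              refine Metric.ball_subset_ball' ?_
              rw [Real.dist_eq]
              linarith
            rw [Set.inter_eq_left.2 hsub, Real.volume_ball]
            refine ENNReal.ofReal_le_ofReal ?_
            have : 0 ≤ (f t - m) ^ 2 / (4 * ρ ^ 2) := by positivity
            simp only [hg]
            linarith
          · have : g t ≤ 0 := by
              have h1 : 2 * ρ < |f t - m| := not_le.1 ht
              have h2 : (2 * ρ) ^ 2 ≤ (f t - m) ^ 2 := by
                rw [← sq_abs (f t - m)]
                exact pow_le_pow_left₀ (by positivity) h1.le 2
              have h3 : 1 ≤ (f t - m) ^ 2 / (4 * ρ ^ 2) := by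
                rw [one_le_div (by positivity)]
                linarith
              simp only [hg]
              linarith
            rw [ENNReal.ofReal_of_nonpos this]
            exact zero_le
  have hlowR : 3 * T / 2 ≤ ∫ z in I, (occ f T z).toReal := by
    rw [integral_toReal (measurable_occ hf T).aemeasurable
      (Filter.Eventually.of_forall fun z => (occ_ne_top f T z).lt_top)]
    refine (ENNReal.ofReal_le_iff_le_toReal ?_).1 hlow
    exact ((setLIntegral_le_lintegral _ _).trans_lt
      (by rw [lintegral_occ hf]; finiteness)).ne
  -- Cauchy–Schwarz in the linearized form `x² ≥ 2 c x - c²`. The best `c` is the mass `3T/2`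
  -- divided by the bound `6ρ` on the length of `I`; that bound is where `1 ≤ ρ` enters.
  set c : ℝ := T / (4 * ρ) with hc
  have hvol : volume.real I = 2 * (2 * ρ + 1) := by
    rw [measureReal_def, Real.volume_ball, ENNReal.toReal_ofReal (by positivity)]
  calc 3 * T ^ 2 / (8 * ρ) = 2 * c * (3 * T / 2) - c ^ 2 * (6 * ρ) := by
        rw [hc]; field_simp; ring
    _ ≤ 2 * c * (∫ z in I, (occ f T z).toReal) - c ^ 2 * (2 * (2 * ρ + 1)) := by
        have : 0 ≤ c := by positivity
        have : c ^ 2 * (2 * (2 * ρ + 1)) ≤ c ^ 2 * (6 * ρ) :=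
          mul_le_mul_of_nonneg_left (by linarith) (sq_nonneg c)
        have : 2 * c * (3 * T / 2) ≤ 2 * c * (∫ z in I, (occ f T z).toReal) :=
          mul_le_mul_of_nonneg_left hlowR (by positivity)
        linarith
    _ = ∫ z in I, (2 * c * (occ f T z).toReal - c ^ 2) := by
        rw [integral_sub ((integrable_occ hf T).integrableOn.const_mul _)
          (integrableOn_const (by rw [hI, Real.volume_ball]; finiteness)), integral_const_mul,
          setIntegral_const, hvol, smul_eq_mul]
        ring
    _ ≤ ∫ z in I, (occ f T z).toReal ^ 2 := by
        refine integral_mono (((integrable_occ hf T).integrableOn.const_mul _).sub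
          (integrableOn_const (by rw [hI, Real.volume_ball]; finiteness)))
          (integrable_occ_sq hf hT.le).integrableOn fun z => ?_
        nlinarith [sq_nonneg ((occ f T z).toReal - c)]
    _ ≤ ∫ z, (occ f T z).toReal ^ 2 :=
        setIntegral_le_integral (integrable_occ_sq hf hT.le)
          (Filter.Eventually.of_forall fun z => by positivity)

end SelfRepellent

/-! ### Gaussian estimates, Cameron–Martin and Jensen -/

section Gaussian

open scoped ENNReal

variable {Ω : Type*} [MeasurableSpace Ω] {P : Measure Ω}

/-- The left side is the exponential moment of a squared Gaussian. The linear coefficient 1 is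
sharp, which the tail of the radius needs; the quadratic coefficient 4 is generous. -/
lemma inv_sqrt_one_sub_two_mul_le {y : ℝ} (h0 : 0 ≤ y) (h1 : y ≤ 1 / 4) :
    (√(1 - 2 * y))⁻¹ ≤ 1 + y + 4 * y ^ 2 := by
  have hs : 0 < √(1 - 2 * y) := Real.sqrt_pos.2 (by linarith)
  rw [inv_le_iff_one_le_mul₀ hs, ← Real.sqrt_sq (show 0 ≤ 1 + y + 4 * y ^ 2 by positivity),
    ← Real.sqrt_mul (sq_nonneg _), Real.one_le_sqrt]
  have h3 : y ^ 3 ≤ y ^ 2 * (1 / 4) := by nlinarith [sq_nonneg y]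
  have h5 : y ^ 5 ≤ y ^ 2 * (1 / 64) := by
    have : y ^ 3 ≤ 1 / 64 := by
      calc y ^ 3 ≤ (1 / 4) ^ 3 := pow_le_pow_left₀ h0 h1 3
        _ = 1 / 64 := by norm_num
    nlinarith [sq_nonneg y]
  nlinarith [sq_nonneg y]

/-- Exponential moment of the square of a centered Gaussian variable. -/
lemma lintegral_exp_mul_sq_gaussianReal_le {a : ℝ} {v : ℝ≥0} (ha : 0 ≤ a) (hav : a * v ≤ 1 / 4) :
    ∫⁻ x, ENNReal.ofReal (Real.exp (a * x ^ 2)) ∂(gaussianReal 0 v) ≤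
      ENNReal.ofReal (1 + a * v + 4 * (a * v) ^ 2) := by
  by_cases hv : v = 0
  · subst hv
    simp
  have hv0 : (0 : ℝ) < v := by positivity
  have hb : 0 < 1 / (2 * (v : ℝ)) - a := by
    rw [sub_pos, lt_div_iff₀ (by positivity)]
    linarith
  rw [gaussianReal_of_var_ne_zero _ hv, lintegral_withDensity_eq_lintegral_mul _
    (measurable_gaussianPDF 0 v) (by fun_prop)]
  have e : ∀ x : ℝ, (gaussianPDF 0 v * fun x => ENNReal.ofReal (Real.exp (a * x ^ 2))) x =
      ENNReal.ofReal ((√(2 * Real.pi * v))⁻¹ *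
        Real.exp (-(1 / (2 * (v : ℝ)) - a) * x ^ 2)) := fun x => by
    rw [Pi.mul_apply, gaussianPDF, gaussianPDFReal, ← ENNReal.ofReal_mul (by positivity), mul_assoc,
      ← Real.exp_add]
    congr 3
    field_simp
    ring
  simp_rw [e]
  rw [← ofReal_integral_eq_lintegral_ofReal ((integrable_exp_neg_mul_sq hb).const_mul _)
    (Filter.Eventually.of_forall fun x => by positivity), integral_const_mul, integral_gaussian]
  refine ENNReal.ofReal_le_ofReal ?_
  refine le_trans (le_of_eq ?_)
    (inv_sqrt_one_sub_two_mul_le (y := a * v) (by positivity) hav)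
  rw [← Real.sqrt_inv, ← Real.sqrt_inv, ← Real.sqrt_mul (by positivity)]
  congr 1
  have : 1 - 2 * (a * v) ≠ 0 := by linarith
  have h2 : 1 / (2 * (v : ℝ)) - a = (1 - 2 * (a * v)) / (2 * v) := by field_simp
  rw [h2]
  field_simp

/-- A Gaussian variable with mean far from the origin and small variance is unlikely to be in
`(-2, 2)`. -/
lemma gaussianReal_ball_le {m : ℝ} {w : ℝ≥0} {u v H : ℝ} (hu : 0 ≤ u) (hv : 0 < v)
    (hw : (w : ℝ) = u ^ (2 * H)) (hm : v * u ≤ m) :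
    gaussianReal m w (Metric.ball 0 2) ≤ (Set.Iio (4 / v)).indicator 1 u +
      ENNReal.ofReal (4 * (u ^ (-H) * Real.exp (-(v ^ 2 / 8) * u ^ (2 - 2 * H)))) := by
  -- Before time `4 / v` the drift has not yet left the ball, and the trivial bound 1 is used.
  by_cases hvu : u < 4 / v
  · rw [Set.indicator_of_mem (by exact hvu)]
    exact prob_le_one.trans le_self_add
  have hvu' : 4 ≤ v * u := by
    rw [not_lt, div_le_iff₀ hv] at hvu
    linarith
  have hu0 : 0 < u := lt_of_lt_of_le (by positivity) (not_lt.1 hvu)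
  have hwpos : (0 : ℝ) < w := by rw [hw]; positivity
  have hw0 : w ≠ 0 := fun h => by simp [h] at hwpos
  rw [Set.indicator_of_notMem (by exact hvu), zero_add, gaussianReal_apply _ hw0]
  calc ∫⁻ x in Metric.ball 0 2, gaussianPDF m w x
      ≤ ∫⁻ x in Metric.ball (0 : ℝ) 2,
          ENNReal.ofReal (u ^ (-H) * Real.exp (-(v ^ 2 / 8) * u ^ (2 - 2 * H))) := by
        refine setLIntegral_mono measurable_const fun x hx => ENNReal.ofReal_le_ofReal ?_
        rw [Metric.mem_ball, Real.dist_eq, sub_zero, abs_lt] at hx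
        rw [gaussianPDFReal]
        refine mul_le_mul ?_ ?_ (by positivity) (by positivity)
        · rw [Real.rpow_neg hu]
          refine inv_anti₀ (by positivity) ?_
          rw [hw]
          refine Real.le_sqrt_of_sq_le ?_
          rw [← Real.rpow_natCast, ← Real.rpow_mul hu, mul_comm H]
          push_cast
          have : 0 ≤ u ^ (2 * H) := by positivity
          nlinarith [Real.pi_gt_three]
        · refine Real.exp_le_exp.2 ?_
          -- Since `x < 2` and `m ≥ v u ≥ 4`, the distance `m - x` is at least `v u / 2`.
          have h1 : (v * u) ^ 2 / 4 ≤ (x - m) ^ 2 := by nlinarith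
          have h2 : u ^ (2 - 2 * H) = u ^ 2 / w := by
            rw [hw, Real.rpow_sub hu0, Real.rpow_two]
          rw [h2, neg_div, neg_mul, neg_le_neg_iff]
          calc v ^ 2 / 8 * (u ^ 2 / w) = ((v * u) ^ 2 / 4) / (2 * w) := by field_simp; norm_num
            _ ≤ (x - m) ^ 2 / (2 * w) := by gcongr
    _ = ENNReal.ofReal (4 * (u ^ (-H) * Real.exp (-(v ^ 2 / 8) * u ^ (2 - 2 * H)))) := by
        rw [setLIntegral_const, Real.volume_ball, ← ENNReal.ofReal_mul (by positivity)]
        congr 1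
        ring

/-- The total time that the bound of `gaussianReal_ball_le` allows is of order `1 / v`. -/
lemma exists_lintegral_hitting_bound_le {H : ℝ} (hH : H ∈ Set.Ioo (0 : ℝ) 1) :
    ∃ K : ℝ, 0 < K ∧ ∀ v : ℝ, 0 < v → ∀ s : ℝ,
      ∫⁻ t : ℝ, ((Set.Iio (4 / v)).indicator 1 |t - s| + ENNReal.ofReal
        (4 * (|t - s| ^ (-H) * Real.exp (-(v ^ 2 / 8) * |t - s| ^ (2 - 2 * H))))) ≤
        ENNReal.ofReal (K / v) := by
  obtain ⟨hH0, hH1⟩ := hH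
  set G : ℝ := √8 * (1 / (2 - 2 * H)) * Real.Gamma (1 / 2) with hG
  have hGpos : 0 < G := by
    have : 0 < Real.Gamma (1 / 2) := Real.Gamma_pos_of_pos (by norm_num)
    have : 0 < 2 - 2 * H := by linarith
    positivity
  refine ⟨8 + 8 * G, by positivity, fun v hv s => ?_⟩
  set κ : ℝ → ℝ≥0∞ := fun u => (Set.Iio (4 / v)).indicator 1 u + ENNReal.ofReal
        (4 * (u ^ (-H) * Real.exp (-(v ^ 2 / 8) * u ^ (2 - 2 * H)))) with hκ
  have hκm : Measurable κ := by
    refine (measurable_one.indicator measurableSet_Iio).add ?_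
    fun_prop
  have hioi : ∫⁻ u in Set.Ioi 0, κ u ≤ ENNReal.ofReal (4 / v + 4 * (G / v)) := by
    rw [hκ, lintegral_add_left (measurable_one.indicator measurableSet_Iio),
      ENNReal.ofReal_add (by positivity) (by positivity)]
    refine add_le_add ?_ ?_
    · rw [lintegral_indicator_one measurableSet_Iio, Measure.restrict_apply measurableSet_Iio]
      refine (measure_mono (t := Set.Ioo 0 (4 / v)) fun x hx => ⟨hx.2, hx.1⟩).trans ?_
      simp
    · have hp : 0 < 2 - 2 * H := by linarith
      have hint := (integrableOn_rpow_mul_exp_neg_mul_rpow (s := -H) (p := 2 - 2 * H)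
        (b := v ^ 2 / 8) (by linarith) hp (by positivity)).const_mul 4
      rw [← ofReal_integral_eq_lintegral_ofReal hint, integral_const_mul,
        integral_rpow_mul_exp_neg_mul_rpow hp (by linarith) (by positivity)]
      · refine le_of_eq ?_
        -- This exponent is `1/2` for every `H`, so the Gamma integral scales exactly as
        -- `(v²)^(-1/2) = 1/v`.
        have e1 : (-H + 1) / (2 - 2 * H) = 1 / 2 := by
          rw [div_eq_div_iff hp.ne' (by norm_num)]; ring
        have e2 : -(-H + 1) / (2 - 2 * H) = -(1 / 2) := by rw [neg_div, e1]
        rw [e1, e2, Real.rpow_neg (by positivity), ← Real.sqrt_eq_rpow, Real.sqrt_div (sq_nonneg v),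
          Real.sqrt_sq hv.le, hG]
        congr 1
        field_simp
      · refine (ae_restrict_iff' measurableSet_Ioi).2 (Filter.Eventually.of_forall fun x hx => ?_)
        have : (0 : ℝ) < x := hx
        positivity
  have habs : ∫⁻ t : ℝ, κ |t| = 2 * ∫⁻ u in Set.Ioi 0, κ u := by
    have h1 : ∫⁻ t in Set.Ioi (0 : ℝ), κ |t| = ∫⁻ u in Set.Ioi 0, κ u :=
      setLIntegral_congr_fun measurableSet_Ioi fun x hx => by
        simp only [abs_of_pos (show (0 : ℝ) < x from hx)]
    have h2 : ∫⁻ t in Set.Iio (0 : ℝ), κ |t| = ∫⁻ u in Set.Ioi 0, κ u := by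
      rw [← h1, ← lintegral_indicator measurableSet_Iio, ← lintegral_indicator measurableSet_Ioi,
        ← lintegral_neg_eq_self]
      refine lintegral_congr fun x => ?_
      simp [Set.indicator]
    rw [← lintegral_add_compl _ (measurableSet_Iio (a := (0 : ℝ))), Set.compl_Iio,
      h2, setLIntegral_congr Ioi_ae_eq_Ici.symm, h1, two_mul]
  calc ∫⁻ t : ℝ, κ |t - s| = ∫⁻ t : ℝ, κ |t| := lintegral_sub_right_eq_self (fun t => κ |t|) s
    _ = 2 * ∫⁻ u in Set.Ioi 0, κ u := habs
    _ ≤ 2 * ENNReal.ofReal (4 / v + 4 * (G / v)) := by gcongr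
    _ = ENNReal.ofReal ((8 + 8 * G) / v) := by
        rw [← ENNReal.ofReal_ofNat, ← ENNReal.ofReal_mul (by norm_num)]
        congr 1
        ring

/-- A moment generating function finite on the whole real line extends analytically to the complex
plane, and the extension determines the law. -/
lemma measure_eq_of_mgf_eq_exp {X : Ω → ℝ} [IsProbabilityMeasure P] {m : ℝ} {w : ℝ≥0}
    (hX : AEMeasurable X P) (h : ∀ t, mgf X P t = Real.exp (m * t + w * t ^ 2 / 2)) :
    P.map X = gaussianReal m w := by
  have hmgf : mgf X P = mgf id (gaussianReal m w) := by
    rw [mgf_id_gaussianReal]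
    exact funext h
  have hset : integrableExpSet X P = Set.univ := by
    ext t
    simp only [Set.mem_univ, iff_true, integrableExpSet, Set.mem_ofPred_eq]
    -- Finiteness comes free: the integral of a non-integrable function is 0 by convention, whereas
    -- the given value is positive.
    rw [← mgf_pos_iff, h]
    exact Real.exp_pos _
  have := eqOn_complexMGF_of_mgf hmgf
  rw [hset] at this
  have hc : complexMGF X P = complexMGF id (gaussianReal m w) :=
    funext fun z => this (by simp)
  rw [Measure.ext_of_complexMGF_eq hX aemeasurable_id hc, Measure.map_id]

/-- The one-dimensional Cameron–Martin formula: tilting by a jointly Gaussian variable shifts the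
mean by the covariance. -/
lemma map_tilted_eq_gaussianReal {X ξ : Ω → ℝ} (h : HasGaussianLaw (fun ω => (X ω, ξ ω)) P)
    (hX : ∫ ω, X ω ∂P = 0) (hξ : ∫ ω, ξ ω ∂P = 0) :
    (P.tilted ξ).map X = gaussianReal (∫ ω, X ω * ξ ω ∂P) (∫ ω, X ω ^ 2 ∂P).toNNReal := by
  have hP : IsProbabilityMeasure P := h.isProbabilityMeasure
  have hXg : HasGaussianLaw X P := h.fst
  have hξg : HasGaussianLaw ξ P := h.snd
  have hXi := hXg.integrable
  have hξi := hξg.integrable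
  have hX2 : Integrable (fun ω => X ω ^ 2) P := hXg.memLp_two.integrable_sq
  have hξ2 : Integrable (fun ω => ξ ω ^ 2) P := hξg.memLp_two.integrable_sq
  have hXξ : Integrable (fun ω => X ω * ξ ω) P := hXg.memLp_two.integrable_mul hξg.memLp_two
  have hexp : ∀ t : ℝ, ∫ ω, Real.exp (ξ ω + t * X ω) ∂P = Real.exp
      (((∫ ω, ξ ω ^ 2 ∂P) + 2 * t * (∫ ω, X ω * ξ ω ∂P) + t ^ 2 * ∫ ω, X ω ^ 2 ∂P) / 2) := by
    intro t
    have hg : HasGaussianLaw (fun ω => ξ ω + t * X ω) P :=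
      h.map (ContinuousLinearMap.snd ℝ ℝ ℝ + t • ContinuousLinearMap.fst ℝ ℝ ℝ)
    have hmean : ∫ ω, (ξ ω + t * X ω) ∂P = 0 := by
      rw [integral_add hξi (hXi.const_mul t), integral_const_mul, hX, hξ]
      simp
    have hvar : Var[fun ω => ξ ω + t * X ω; P] =
        (∫ ω, ξ ω ^ 2 ∂P) + 2 * t * (∫ ω, X ω * ξ ω ∂P) + t ^ 2 * ∫ ω, X ω ^ 2 ∂P := by
      rw [variance_of_integral_eq_zero hg.aemeasurable hmean, ← integral_const_mul,
        ← integral_const_mul, ← integral_add hξ2 (hXξ.const_mul _),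
        ← integral_add (by exact hξ2.add (hXξ.const_mul _)) (hX2.const_mul _)]
      exact integral_congr_ae (Filter.Eventually.of_forall fun ω => by ring)
    have := mgf_gaussianReal hg.map_eq_gaussianReal 1
    rw [hmean, Real.coe_toNNReal _ (variance_nonneg _ _), hvar] at this
    simpa [mgf] using this
  have hexp0 : ∫ ω, Real.exp (ξ ω) ∂P = Real.exp ((∫ ω, ξ ω ^ 2 ∂P) / 2) := by
    simpa using hexp 0
  have hint : Integrable (fun ω => Real.exp (ξ ω)) P := by
    by_contra hn
    rw [integral_undef hn] at hexp0
    exact (Real.exp_pos _).ne hexp0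
  have hQ : IsProbabilityMeasure (P.tilted ξ) := isProbabilityMeasure_tilted hint
  refine measure_eq_of_mgf_eq_exp
    (hXg.aemeasurable.mono_ac (tilted_absolutelyContinuous P ξ)) fun t => ?_
  rw [mgf, integral_exp_tilted, hexp0]
  have := hexp t
  simp only [Pi.add_apply]
  rw [this, ← Real.exp_sub, Real.coe_toNNReal _ (integral_nonneg fun ω => sq_nonneg _)]
  congr 1
  ring

/-- Jensen's inequality for the change of measure by a centered Gaussian variable. -/
lemma exp_le_integral_exp_neg {ξ F : Ω → ℝ} (hξ : HasGaussianLaw ξ P) (hξ0 : ∫ ω, ξ ω ∂P = 0)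
    (hF : Integrable F (P.tilted ξ)) (hexpF : Integrable (fun ω => Real.exp (-F ω)) P) :
    Real.exp (-(∫ ω, F ω ∂(P.tilted ξ)) - (∫ ω, ξ ω ^ 2 ∂P) / 2) ≤
      ∫ ω, Real.exp (-F ω) ∂P := by
  have hP : IsProbabilityMeasure P := hξ.isProbabilityMeasure
  have hpair : HasGaussianLaw (fun ω => (ξ ω, ξ ω)) P :=
    hξ.map ((ContinuousLinearMap.id ℝ ℝ).prod (ContinuousLinearMap.id ℝ ℝ))
  have hlaw := map_tilted_eq_gaussianReal hpair hξ0 hξ0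
  have hmQ : AEMeasurable ξ (P.tilted ξ) :=
    hξ.aemeasurable.mono_ac (tilted_absolutelyContinuous P ξ)
  have hmgf := mgf_gaussianReal hξ.map_eq_gaussianReal 1
  rw [hξ0, Real.coe_toNNReal _ (variance_nonneg _ _),
    variance_of_integral_eq_zero hξ.aemeasurable hξ0] at hmgf
  have hexp : ∫ ω, Real.exp (ξ ω) ∂P = Real.exp ((∫ ω, ξ ω ^ 2 ∂P) / 2) := by
    simpa [mgf] using hmgf
  have hint : Integrable (fun ω => Real.exp (ξ ω)) P := by
    by_contra hn
    rw [integral_undef hn] at hexp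
    exact (Real.exp_pos _).ne hexp
  have hQ : IsProbabilityMeasure (P.tilted ξ) := isProbabilityMeasure_tilted hint
  have hmean : ∫ ω, ξ ω ∂(P.tilted ξ) = ∫ ω, ξ ω ^ 2 ∂P := by
    have := integral_map hmQ (f := fun x : ℝ => x) (by fun_prop)
    rw [← this, hlaw, integral_id_gaussianReal]
    simp only [sq]
  have hξQ : Integrable ξ (P.tilted ξ) := by
    have := (memLp_id_gaussianReal (μ := ∫ ω, ξ ω * ξ ω ∂P)
      (v := (∫ ω, ξ ω ^ 2 ∂P).toNNReal) 1)
    rw [← hlaw, memLp_map_measure_iff (by fun_prop) hmQ] at this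
    exact memLp_one_iff_integrable.1 this
  have htilt : ∫ ω, Real.exp (-F ω - ξ ω) ∂(P.tilted ξ) =
      (∫ ω, Real.exp (-F ω) ∂P) / ∫ ω, Real.exp (ξ ω) ∂P := by
    rw [integral_exp_tilted]
    congr 2
    ext ω
    simp
  have hpos : 0 < (∫ ω, Real.exp (-F ω) ∂P) / ∫ ω, Real.exp (ξ ω) ∂P :=
    div_pos (integral_exp_pos hexpF) (integral_exp_pos hint)
  have hintQ : Integrable (fun ω => Real.exp (-F ω - ξ ω)) (P.tilted ξ) := by
    by_contra hn
    rw [integral_undef hn] at htilt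
    exact hpos.ne htilt
  -- Jensen under the tilted law. There `ξ` has mean equal to its variance `σ²`, and the
  -- normalization contributes `σ²/2`, so the net entropy cost is `σ²/2`.
  have hJ : Real.exp (∫ ω, (-F ω - ξ ω) ∂(P.tilted ξ)) ≤
      ∫ ω, Real.exp (-F ω - ξ ω) ∂(P.tilted ξ) :=
    convexOn_exp.map_integral_le Real.continuous_exp.continuousOn isClosed_univ
      (by simp) (hF.neg.sub hξQ) hintQ
  rw [htilt, integral_sub (by exact hF.neg) hξQ, integral_neg, hmean, le_div_iff₀ (integral_exp_pos hint),
    hexp, ← Real.exp_add] at hJ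
  refine le_trans (le_of_eq ?_) hJ
  congr 1
  ring

end Gaussian

/-! ### Upper tail of the radius of gyration -/

namespace SelfRepellent

open scoped ENNReal

variable {Ω : Type*} {H : ℝ} {B : ℝ≥0 → Ω → ℝ} {T : ℝ}

lemma occupationTime_eq_occ (B : ℝ≥0 → Ω → ℝ) (T : ℝ) (ω : Ω) (z : ℝ) :
    occupationTime B T ω z = (occ (fun t => B t.toNNReal ω) T z).toReal := rfl

lemma integral_sub_average_sq_eq {f : ℝ → ℝ} (hf : Continuous f) (hT : 0 < T) {m : ℝ}
    (hm : m = (1 / T) * ∫ t in (0 : ℝ)..T, f t) :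
    ∫ t in (0 : ℝ)..T, (f t - m) ^ 2 = (∫ t in (0 : ℝ)..T, f t ^ 2) - T * m ^ 2 := by
  have hI : ∫ t in (0 : ℝ)..T, f t = T * m := by rw [hm]; field_simp
  have e : ∀ t, (f t - m) ^ 2 = f t ^ 2 - 2 * m * f t + m ^ 2 := fun t => by ring
  simp_rw [e]
  rw [intervalIntegral.integral_add, intervalIntegral.integral_sub,
    intervalIntegral.integral_const_mul, hI, intervalIntegral.integral_const]
  · simp only [sub_zero, smul_eq_mul]
    ring
  all_goals exact Continuous.intervalIntegrable (by fun_prop) _ _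

lemma radius_sq_eq (hT : 0 < T) (ω : Ω) :
    radius B T ω ^ 2 =
      (1 / T) * ∫ t in (0 : ℝ)..T, (B t.toNNReal ω - timeAverage B T ω) ^ 2 := by
  rw [radius, Real.sq_sqrt]
  · simp only [sq_abs]
  · exact mul_nonneg (by positivity)
      (intervalIntegral.integral_nonneg hT.le fun t _ => by positivity)

lemma radius_nonneg (B : ℝ≥0 → Ω → ℝ) (T : ℝ) (ω : Ω) : 0 ≤ radius B T ω := Real.sqrt_nonneg _

lemma weight_nonneg (β : ℝ) (B : ℝ≥0 → Ω → ℝ) (T : ℝ) (ω : Ω) : 0 ≤ weight β B T ω :=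
  (Real.exp_pos _).le

lemma weight_le_one {β : ℝ} (hβ : 0 ≤ β) (B : ℝ≥0 → Ω → ℝ) (T : ℝ) (ω : Ω) :
    weight β B T ω ≤ 1 := by
  refine Real.exp_le_one_iff.2 ?_
  have : 0 ≤ ∫ z : ℝ, occupationTime B T ω z ^ 2 := integral_nonneg fun z => sq_nonneg _
  nlinarith

/-- The exponential of the squared radius of gyration is at most the time average of the
exponential of the squared path. -/
lemma exp_mul_radius_sq_le {ω : Ω} (hc : Continuous fun t : ℝ => B t.toNNReal ω) (hT : 0 < T)
    {a : ℝ} (ha : 0 ≤ a) :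
    Real.exp (a * radius B T ω ^ 2) ≤
      (1 / T) * ∫ t in Set.Icc 0 T, Real.exp (a * B t.toNNReal ω ^ 2) := by
  have hvol : volume.real (Set.Icc 0 T) = T := by simp [hT.le]
  have hJ : Real.exp (⨍ t in Set.Icc 0 T, a * B t.toNNReal ω ^ 2) ≤
      ⨍ t in Set.Icc 0 T, Real.exp (a * B t.toNNReal ω ^ 2) := by
    refine convexOn_exp.map_set_average_le Real.continuous_exp.continuousOn isClosed_univ
      ?_ ?_ (by simp) ?_ ?_
    · simp [hT]
    · simp
    · exact ((hc.pow 2).const_mul a).integrableOn_Icc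
    · exact (Real.continuous_exp.comp ((hc.pow 2).const_mul a)).integrableOn_Icc
  rw [setAverage_eq, setAverage_eq, hvol, smul_eq_mul, smul_eq_mul, ← one_div] at hJ
  refine le_trans (Real.exp_le_exp.2 ?_) hJ
  rw [radius_sq_eq hT, integral_sub_average_sq_eq hc hT (m := timeAverage B T ω) rfl, integral_const_mul,
    integral_Icc_eq_integral_Ioc, ← intervalIntegral.integral_of_le hT.le, mul_left_comm a]
  -- Centering at the time average only lowers the second moment, so the squared mean can be
  -- dropped.
  have : 0 ≤ T * timeAverage B T ω ^ 2 := by positivity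
  gcongr
  linarith

lemma timeAverage_rpow_eq (hH : 0 < H) (lam : ℝ) (hT : 0 < T) :
    (1 / T) * ∫ t in Set.Icc 0 T, (1 + lam / T ^ (2 * H) * t ^ (2 * H) + 4 * lam ^ 2) =
      1 + lam / (2 * H + 1) + 4 * lam ^ 2 := by
  have hc : Continuous fun t : ℝ => t ^ (2 * H) := Real.continuous_rpow_const (by positivity)
  have hI : ∫ t in (0 : ℝ)..T, t ^ (2 * H) = T ^ (2 * H) * T / (2 * H + 1) := by
    rw [integral_rpow (Or.inl (by linarith)), Real.zero_rpow (by positivity),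
      Real.rpow_add_one hT.ne', sub_zero]
  rw [integral_Icc_eq_integral_Ioc, ← intervalIntegral.integral_of_le hT.le,
    intervalIntegral.integral_add (Continuous.intervalIntegrable (by fun_prop) _ _) (by simp),
    intervalIntegral.integral_add (by simp) (Continuous.intervalIntegrable (by fun_prop) _ _),
    intervalIntegral.integral_const_mul, hI, intervalIntegral.integral_const,
    intervalIntegral.integral_const, smul_eq_mul, smul_eq_mul, sub_zero]
  have : T ^ (2 * H) ≠ 0 := by positivity
  field_simp

variable [MeasurableSpace Ω] {P : Measure Ω}

lemma IsFBM.integral_sq (hB : IsFBM H B P) (hH : 0 < H) (t : ℝ≥0) :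
    ∫ ω, B t ω ^ 2 ∂P = (t : ℝ) ^ (2 * H) := by
  have := hB.covariance t t
  rw [sub_self, abs_zero, Real.zero_rpow (by positivity)] at this
  simp only [sq, this]
  ring

lemma IsFBM.map_eq (hB : IsFBM H B P) (hH : 0 < H) (t : ℝ≥0) :
    P.map (B t) = gaussianReal 0 ((t : ℝ) ^ (2 * H)).toNNReal := by
  rw [(hB.isGaussianProcess.hasGaussianLaw_eval t).map_eq_gaussianReal, hB.mean_zero,
    variance_of_integral_eq_zero (hB.isGaussianProcess.aemeasurable t) (hB.mean_zero t),
    hB.integral_sq hH]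

lemma IsFBM.lintegral_exp_sq_le (hB : IsFBM H B P) (hH : 0 < H) {lam : ℝ} (h0 : 0 ≤ lam)
    (h1 : lam ≤ 1 / 4) (hT : 0 < T) {t : ℝ} (ht : t ∈ Set.Icc 0 T) :
    ∫⁻ ω, ENNReal.ofReal (Real.exp (lam / T ^ (2 * H) * B t.toNNReal ω ^ 2)) ∂P ≤
      ENNReal.ofReal (1 + lam / T ^ (2 * H) * t ^ (2 * H) + 4 * lam ^ 2) := by
  have hTH : 0 < T ^ (2 * H) := by positivity
  have htH : 0 ≤ t ^ (2 * H) := Real.rpow_nonneg ht.1 _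
  have hle : lam / T ^ (2 * H) * t ^ (2 * H) ≤ lam := by
    rw [div_mul_eq_mul_div, div_le_iff₀ hTH]
    exact mul_le_mul_of_nonneg_left (Real.rpow_le_rpow ht.1 ht.2 (by positivity)) h0
  have hmap := lintegral_map' (μ := P) (g := B t.toNNReal)
    (f := fun x => ENNReal.ofReal (Real.exp (lam / T ^ (2 * H) * x ^ 2)))
    (by fun_prop) (hB.isGaussianProcess.aemeasurable _)
  rw [← hmap, hB.map_eq hH, Real.coe_toNNReal _ ht.1]
  have hv : (((t ^ (2 * H)).toNNReal : ℝ≥0) : ℝ) = t ^ (2 * H) := Real.coe_toNNReal _ htH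
  refine (lintegral_exp_mul_sq_gaussianReal_le (by positivity) (by rw [hv]; linarith)).trans ?_
  rw [hv]
  refine ENNReal.ofReal_le_ofReal ?_
  gcongr

namespace IsRegularFBM

variable (hB : IsRegularFBM H B P)
include hB

/-- Jensen in time and Fubini reduce this to one-dimensional Gaussian moments. Averaging the
variance `t^(2H)` over `[0, T]` gains the factor `1 / (2H + 1) < 1` in the linear term, and this
gain is what makes the tail bound nontrivial already at `r = T^H`. -/
lemma lintegral_exp_radius_sq_le (hH : 0 < H) {lam : ℝ} (h0 : 0 ≤ lam) (h1 : lam ≤ 1 / 4)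
    (hT : 0 < T) :
    ∫⁻ ω, ENNReal.ofReal (Real.exp (lam / T ^ (2 * H) * radius B T ω ^ 2)) ∂P ≤
      ENNReal.ofReal (1 + lam / (2 * H + 1) + 4 * lam ^ 2) := by
  have hP : IsProbabilityMeasure P := hB.isGaussianProcess.isProbabilityMeasure
  have hTH : 0 < T ^ (2 * H) := by positivity
  have ha : 0 ≤ lam / T ^ (2 * H) := by positivity
  let g : Ω × ℝ → ℝ≥0∞ := fun p =>
    ENNReal.ofReal (Real.exp (lam / T ^ (2 * H) * B p.2.toNNReal p.1 ^ 2))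
  have hm : Measurable g :=
    ((hB.measurable_uncurry.pow_const 2).const_mul _).exp.ennreal_ofReal
  have hgc : Continuous fun t : ℝ => 1 + lam / T ^ (2 * H) * t ^ (2 * H) + 4 * lam ^ 2 := by
    have : Continuous fun t : ℝ => t ^ (2 * H) := Real.continuous_rpow_const (by positivity)
    fun_prop
  calc ∫⁻ ω, ENNReal.ofReal (Real.exp (lam / T ^ (2 * H) * radius B T ω ^ 2)) ∂P
      ≤ ∫⁻ ω, (ENNReal.ofReal (1 / T) * ∫⁻ t in Set.Icc 0 T,
          ENNReal.ofReal (Real.exp (lam / T ^ (2 * H) * B t.toNNReal ω ^ 2))) ∂P := by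
        refine lintegral_mono fun ω => ?_
        have hc := hB.continuous_real_path ω
        have hce : Continuous fun t : ℝ =>
            Real.exp (lam / T ^ (2 * H) * B t.toNNReal ω ^ 2) :=
          Real.continuous_exp.comp ((hc.pow 2).const_mul _)
        rw [← ofReal_integral_eq_lintegral_ofReal hce.integrableOn_Icc
          (Filter.Eventually.of_forall fun t => by positivity),
          ← ENNReal.ofReal_mul (by positivity)]
        exact ENNReal.ofReal_le_ofReal (exp_mul_radius_sq_le hc hT ha)
    _ = ENNReal.ofReal (1 / T) * ∫⁻ t in Set.Icc 0 T, ∫⁻ ω,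
          ENNReal.ofReal (Real.exp (lam / T ^ (2 * H) * B t.toNNReal ω ^ 2)) ∂P := by
        rw [lintegral_const_mul _ (Measurable.lintegral_prod_right' (f := g) hm)]
        congr 1
        exact lintegral_lintegral_swap (f := fun ω t => g (ω, t)) hm.aemeasurable
    _ ≤ ENNReal.ofReal (1 / T) * ∫⁻ t in Set.Icc 0 T,
          ENNReal.ofReal (1 + lam / T ^ (2 * H) * t ^ (2 * H) + 4 * lam ^ 2) := by
        gcongr 1
        exact setLIntegral_mono hgc.measurable.ennreal_ofReal fun t ht =>
          hB.lintegral_exp_sq_le hH h0 h1 hT ht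
    _ = ENNReal.ofReal (1 + lam / (2 * H + 1) + 4 * lam ^ 2) := by
        rw [← ofReal_integral_eq_lintegral_ofReal hgc.integrableOn_Icc ?_,
          ← ENNReal.ofReal_mul (by positivity), timeAverage_rpow_eq hH lam hT]
        refine (ae_restrict_iff' measurableSet_Icc).2 (Filter.Eventually.of_forall fun t ht => ?_)
        have : 0 ≤ t ^ (2 * H) := Real.rpow_nonneg ht.1 _
        have : 0 ≤ lam / T ^ (2 * H) * t ^ (2 * H) := mul_nonneg ha this
        have : 0 ≤ lam ^ 2 := sq_nonneg lam
        simp only [Pi.zero_apply]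
        linarith

/-- Gaussian upper tail of the radius of gyration. -/
lemma measure_le_radius_le (hH : 0 < H) (hT : 0 < T) {r : ℝ} (hr : T ^ H ≤ r) :
    P {ω | r ≤ radius B T ω} ≤ ENNReal.ofReal
      (Real.exp (-((1 - 1 / (2 * H + 1)) ^ 2 / 16) * (r ^ 2 / T ^ (2 * H)))) := by
  set θ : ℝ := 1 / (2 * H + 1) with hθ
  have hθ0 : 0 < θ := by positivity
  have hθ1 : θ < 1 := by
    rw [hθ, div_lt_one (by positivity)]
    linarith
  set lam : ℝ := (1 - θ) / 8 with hlam
  have hTH : 0 < T ^ (2 * H) := by positivity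
  have hx : 1 ≤ r ^ 2 / T ^ (2 * H) := by
    rw [one_le_div hTH, two_mul, Real.rpow_add hT, ← sq]
    exact pow_le_pow_left₀ (by positivity) hr 2
  have hmarkov := meas_ge_le_lintegral_div (μ := P)
    (f := fun ω => ENNReal.ofReal (Real.exp (lam / T ^ (2 * H) * radius B T ω ^ 2)))
    ((((hB.measurable_radius T).pow_const 2).const_mul _).exp.ennreal_ofReal.aemeasurable)
    (ε := ENNReal.ofReal (Real.exp (lam * (r ^ 2 / T ^ (2 * H)))))
    (by simp [Real.exp_pos]) (by finiteness)
  have hr0 : 0 ≤ r := le_trans (by positivity) hr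
  calc P {ω | r ≤ radius B T ω}
      ≤ P {ω | ENNReal.ofReal (Real.exp (lam * (r ^ 2 / T ^ (2 * H)))) ≤
          ENNReal.ofReal (Real.exp (lam / T ^ (2 * H) * radius B T ω ^ 2))} := by
        refine measure_mono fun ω hω => ENNReal.ofReal_le_ofReal (Real.exp_le_exp.2 ?_)
        have h2 : r ^ 2 ≤ radius B T ω ^ 2 := pow_le_pow_left₀ hr0 hω 2
        have : 0 ≤ lam / T ^ (2 * H) := by
          have : 0 ≤ lam := by rw [hlam]; linarith
          positivity
        calc lam * (r ^ 2 / T ^ (2 * H)) = lam / T ^ (2 * H) * r ^ 2 := by ring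
          _ ≤ _ := mul_le_mul_of_nonneg_left h2 this
    _ ≤ _ := hmarkov
    _ ≤ ENNReal.ofReal (1 + lam / (2 * H + 1) + 4 * lam ^ 2) /
          ENNReal.ofReal (Real.exp (lam * (r ^ 2 / T ^ (2 * H)))) := by
        gcongr
        exact hB.lintegral_exp_radius_sq_le hH (by rw [hlam]; linarith) (by rw [hlam]; linarith) hT
    _ ≤ _ := by
        rw [← ENNReal.ofReal_div_of_pos (Real.exp_pos _)]
        refine ENNReal.ofReal_le_ofReal ?_
        rw [div_le_iff₀ (Real.exp_pos _), ← Real.exp_add]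
        have h1 : 1 + lam / (2 * H + 1) + 4 * lam ^ 2 ≤ Real.exp (lam * θ + 4 * lam ^ 2) := by
          have := Real.add_one_le_exp (lam * θ + 4 * lam ^ 2)
          have e : lam / (2 * H + 1) = lam * θ := by rw [hθ]; ring
          rw [e]
          linarith
        refine h1.trans (Real.exp_le_exp.2 ?_)
        have e : lam * θ + 4 * lam ^ 2 = (1 - θ) * (1 + θ) / 16 := by rw [hlam]; ring
        rw [e, hlam]
        have : 0 ≤ (1 - θ) * (1 + θ) / 16 := by nlinarith
        nlinarith [mul_le_mul_of_nonneg_left hx this]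

lemma setIntegral_weight_le (hH : 0 < H) {β : ℝ} (hβ : 0 ≤ β) (hT : 0 < T) {r : ℝ}
    (hr : T ^ H ≤ r) :
    ∫ ω in {ω | r ≤ radius B T ω}, weight β B T ω ∂P ≤
      Real.exp (-((1 - 1 / (2 * H + 1)) ^ 2 / 16) * (r ^ 2 / T ^ (2 * H))) := by
  have hP : IsProbabilityMeasure P := hB.isGaussianProcess.isProbabilityMeasure
  have h := hB.measure_le_radius_le hH hT hr
  calc ∫ ω in {ω | r ≤ radius B T ω}, weight β B T ω ∂P
      ≤ ∫ ω in {ω | r ≤ radius B T ω}, (1 : ℝ) ∂P :=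
        integral_mono_of_nonneg (Filter.Eventually.of_forall fun ω => weight_nonneg β B T ω)
          (integrable_const _) (Filter.Eventually.of_forall fun ω => weight_le_one hβ B T ω)
    _ = P.real {ω | r ≤ radius B T ω} := by simp
    _ ≤ _ := ENNReal.toReal_le_of_le_ofReal (Real.exp_pos _).le h

end IsRegularFBM

end SelfRepellent

/-! ### Linear growth of the covariance with the endpoint -/

section Rpow

/-- For `p ≤ 0` the power is decreasing, and for `0 ≤ p ≤ 1` it is subadditive. With `p = 2H - 1`
the two cases treat rough and smooth paths at once. -/
lemma half_rpow_le_add_rpow {a b p : ℝ} (ha : 0 < a) (hb : 0 < b) (hp : p ≤ 1) :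
    (a + b) ^ p / 2 ≤ a ^ p + b ^ p := by
  have hap : 0 < a ^ p := Real.rpow_pos_of_pos ha p
  have hbp : 0 < b ^ p := Real.rpow_pos_of_pos hb p
  rcases le_total p 0 with h | h
  · have : (a + b) ^ p ≤ a ^ p := Real.rpow_le_rpow_of_nonpos ha (by linarith) h
    linarith
  · have := Real.rpow_add_le_add_rpow ha.le hb.le h hp
    linarith

/-- The covariance of fractional Brownian motion with its endpoint grows at least linearly. -/
lemma mul_sub_le_rpow_sub_rpow {H T s t : ℝ} (hH : H ∈ Set.Ioo (0 : ℝ) 1) (hs : 0 ≤ s)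
    (hst : s ≤ t) (ht : t ≤ T) :
    H * T ^ (2 * H - 1) * (t - s) ≤
      (t ^ (2 * H) - (T - t) ^ (2 * H)) - (s ^ (2 * H) - (T - s) ^ (2 * H)) := by
  obtain ⟨hH0, hH1⟩ := hH
  have hderiv : ∀ x ∈ Set.Ioo 0 T, HasDerivAt (fun x => x ^ (2 * H) - (T - x) ^ (2 * H))
      (2 * H * x ^ (2 * H - 1) + 2 * H * (T - x) ^ (2 * H - 1)) x := fun x hx => by
    have h1 := Real.hasDerivAt_rpow_const (x := x) (p := 2 * H) (Or.inl hx.1.ne')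
    have h2 := (((hasDerivAt_id x).const_sub T).rpow_const (p := 2 * H)
      (Or.inl (sub_pos.2 hx.2).ne'))
    refine (h1.sub h2).congr_deriv ?_
    simp only [id]
    ring
  have hcont : Continuous fun x : ℝ => x ^ (2 * H) - (T - x) ^ (2 * H) :=
    (Real.continuous_rpow_const (by positivity)).sub
      ((Real.continuous_rpow_const (by positivity)).comp (continuous_const.sub continuous_id))
  refine (convex_Icc 0 T).mul_sub_le_image_sub_of_le_deriv hcont.continuousOn ?_ ?_ s
    ⟨hs, hst.trans ht⟩ t ⟨hs.trans hst, ht⟩ hst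
  · rw [interior_Icc]
    exact fun x hx => (hderiv x hx).differentiableAt.differentiableWithinAt
  · rw [interior_Icc]
    intro x hx
    rw [(hderiv x hx).deriv]
    have := half_rpow_le_add_rpow (p := 2 * H - 1) hx.1 (sub_pos.2 hx.2) (by linarith)
    rw [add_sub_cancel] at this
    nlinarith

end Rpow

/-! ### Lower bound for the partition function -/

namespace SelfRepellent

open scoped ENNReal

variable {Ω : Type*} [MeasurableSpace Ω] {P : Measure Ω} {H : ℝ} {B : ℝ≥0 → Ω → ℝ} {T : ℝ}

namespace IsFBM

variable (hB : IsFBM H B P)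
include hB

lemma memLp_two (t : ℝ≥0) : MemLp (B t) 2 P :=
  (hB.isGaussianProcess.hasGaussianLaw_eval t).memLp_two

lemma integrable_mul (s t : ℝ≥0) : Integrable (fun ω => B s ω * B t ω) P :=
  (hB.memLp_two s).integrable_mul (hB.memLp_two t)

lemma hasGaussianLaw_increment_endpoint (s t r : ℝ≥0) (lam : ℝ) :
    HasGaussianLaw (fun ω => (B t ω - B s ω, lam * B r ω)) P := by
  classical
  have h := hB.isGaussianProcess.hasGaussianLaw {s, t, r}
  let π (i : ℝ≥0) (hi : i ∈ ({s, t, r} : Finset ℝ≥0)) :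
      (({s, t, r} : Finset ℝ≥0) → ℝ) →L[ℝ] ℝ := ContinuousLinearMap.proj ⟨i, hi⟩
  exact h.map (((π t (by simp)) - (π s (by simp))).prod (lam • (π r (by simp))))

lemma integral_increment_sq (hH : 0 < H) (s t : ℝ≥0) :
    ∫ ω, (B t ω - B s ω) ^ 2 ∂P = |(t : ℝ) - s| ^ (2 * H) := by
  have e : ∀ ω, (B t ω - B s ω) ^ 2 = B t ω ^ 2 - 2 * (B s ω * B t ω) + B s ω ^ 2 :=
    fun ω => by ring
  simp_rw [e]
  rw [integral_add, integral_sub, integral_const_mul, hB.integral_sq hH, hB.integral_sq hH,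
    hB.covariance]
  · ring
  · exact (hB.memLp_two t).integrable_sq
  · exact (hB.integrable_mul s t).const_mul 2
  · exact (hB.memLp_two t).integrable_sq.sub ((hB.integrable_mul s t).const_mul 2)
  · exact (hB.memLp_two s).integrable_sq

lemma integral_increment_mul (s t r : ℝ≥0) (lam : ℝ) :
    ∫ ω, (B t ω - B s ω) * (lam * B r ω) ∂P = lam / 2 *
      (((t : ℝ) ^ (2 * H) - |(r : ℝ) - t| ^ (2 * H)) -
        ((s : ℝ) ^ (2 * H) - |(r : ℝ) - s| ^ (2 * H))) := by
  have e : ∀ ω, (B t ω - B s ω) * (lam * B r ω) =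
      lam * (B t ω * B r ω) - lam * (B s ω * B r ω) := fun ω => by ring
  simp_rw [e]
  rw [integral_sub ((hB.integrable_mul t r).const_mul lam)
    ((hB.integrable_mul s r).const_mul lam), integral_const_mul, integral_const_mul,
    hB.covariance, hB.covariance]
  ring

/-- Under the tilt by a multiple of the endpoint the process has a drift, hence spends little time
close to itself. -/
lemma tilted_increment_le (hH : H ∈ Set.Ioo (0 : ℝ) 1) (hT : 0 < T) {lam : ℝ} (hlam : 0 < lam)
    {s t : ℝ} (hs : 0 ≤ s) (hst : s ≤ t) (ht : t ≤ T) :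
    (P.tilted fun ω => lam * B T.toNNReal ω)
        {ω | |B t.toNNReal ω - B s.toNNReal ω| < 2} ≤
      (Set.Iio (4 / (lam * (H / 2) * T ^ (2 * H - 1)))).indicator 1 |t - s| +
        ENNReal.ofReal (4 * (|t - s| ^ (-H) *
          Real.exp (-((lam * (H / 2) * T ^ (2 * H - 1)) ^ 2 / 8) * |t - s| ^ (2 - 2 * H)))) := by
  obtain ⟨hH0, hH1⟩ := hH
  set Q := P.tilted fun ω => lam * B T.toNNReal ω
  have hg := hB.hasGaussianLaw_increment_endpoint s.toNNReal t.toNNReal T.toNNReal lam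
  have hint : ∀ r, Integrable (B r) P := fun r =>
    (hB.isGaussianProcess.hasGaussianLaw_eval r).integrable
  have hlaw := map_tilted_eq_gaussianReal hg
    (by rw [integral_sub (hint _) (hint _), hB.mean_zero, hB.mean_zero, sub_zero])
    (by rw [integral_const_mul, hB.mean_zero, mul_zero])
  have hX : AEMeasurable (fun ω => B t.toNNReal ω - B s.toNNReal ω) Q :=
    hg.fst.aemeasurable.mono_ac (tilted_absolutelyContinuous P _)
  have hset : {ω | |B t.toNNReal ω - B s.toNNReal ω| < 2} =
      (fun ω => B t.toNNReal ω - B s.toNNReal ω) ⁻¹' Metric.ball 0 2 := by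
    ext ω
    simp
  rw [hset, ← Measure.map_apply_of_aemeasurable hX measurableSet_ball, hlaw]
  refine gaussianReal_ball_le (abs_nonneg _) (by positivity) ?_ ?_
  · rw [hB.integral_increment_sq hH0, Real.coe_toNNReal _ (hs.trans hst), Real.coe_toNNReal _ hs,
      Real.coe_toNNReal _ (by positivity)]
  · rw [hB.integral_increment_mul, Real.coe_toNNReal _ (hs.trans hst), Real.coe_toNNReal _ hs,
      Real.coe_toNNReal _ hT.le, abs_of_nonneg (sub_nonneg.2 ht),
      abs_of_nonneg (sub_nonneg.2 (hst.trans ht)), abs_of_nonneg (sub_nonneg.2 hst)]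
    have := mul_sub_le_rpow_sub_rpow ⟨hH0, hH1⟩ hs hst ht
    calc lam * (H / 2) * T ^ (2 * H - 1) * (t - s)
        = lam / 2 * (H * T ^ (2 * H - 1) * (t - s)) := by ring
      _ ≤ _ := mul_le_mul_of_nonneg_left this (by positivity)

lemma tilted_increment_le' (hH : H ∈ Set.Ioo (0 : ℝ) 1) (hT : 0 < T) {lam : ℝ} (hlam : 0 < lam)
    {s t : ℝ} (hs : s ∈ Set.Icc 0 T) (ht : t ∈ Set.Icc 0 T) :
    (P.tilted fun ω => lam * B T.toNNReal ω)
        {ω | |B s.toNNReal ω - B t.toNNReal ω| < 2} ≤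
      (Set.Iio (4 / (lam * (H / 2) * T ^ (2 * H - 1)))).indicator 1 |t - s| +
        ENNReal.ofReal (4 * (|t - s| ^ (-H) *
          Real.exp (-((lam * (H / 2) * T ^ (2 * H - 1)) ^ 2 / 8) * |t - s| ^ (2 - 2 * H)))) := by
  rcases le_total s t with h | h
  · simp only [abs_sub_comm (B s.toNNReal _)]
    exact hB.tilted_increment_le hH hT hlam hs.1 h ht.2
  · rw [abs_sub_comm t s]
    exact hB.tilted_increment_le hH hT hlam ht.1 h hs.2

end IsFBM

omit [MeasurableSpace Ω] in
lemma ofReal_selfIntersection {ω : Ω} (hc : Continuous fun t : ℝ => B t.toNNReal ω) (hT : 0 ≤ T) :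
    ENNReal.ofReal (∫ z : ℝ, occupationTime B T ω z ^ 2) =
      ∫⁻ z, occ (fun t => B t.toNNReal ω) T z ^ 2 := by
  simp only [occupationTime_eq_occ]
  rw [ofReal_integral_eq_lintegral_ofReal (integrable_occ_sq hc hT)
    (Filter.Eventually.of_forall fun z => by positivity)]
  refine lintegral_congr fun z => ?_
  rw [ENNReal.ofReal_pow ENNReal.toReal_nonneg, ENNReal.ofReal_toReal (occ_ne_top _ _ _)]

namespace IsRegularFBM

variable (hB : IsRegularFBM H B P)
include hB

/-- Fubini turns the expected self-intersection into an integral, over pairs of times, of the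
probability that the path is near itself. The kernel is integrated over all `t`, which gives a bound
linear in `T`. -/
lemma lintegral_selfIntersection_le {Q : Measure Ω} [SFinite Q] (hT : 0 ≤ T) {κ : ℝ → ℝ → ℝ≥0∞}
    {A : ℝ}
    (hκ : ∀ s ∈ Set.Icc 0 T, ∀ t ∈ Set.Icc 0 T,
      Q {ω | |B s.toNNReal ω - B t.toNNReal ω| < 2} ≤ κ s t)
    (hA : ∀ s, ∫⁻ t, κ s t ≤ ENNReal.ofReal A) :
    ∫⁻ ω, ENNReal.ofReal (∫ z : ℝ, occupationTime B T ω z ^ 2) ∂Q ≤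
      ENNReal.ofReal (2 * A * T) := by
  let g : Ω × ℝ × ℝ → ℝ≥0∞ := fun p =>
    {p : Ω × ℝ × ℝ | |B p.2.1.toNNReal p.1 - B p.2.2.toNNReal p.1| < 2}.indicator 1 p
  have hset : MeasurableSet
      {p : Ω × ℝ × ℝ | |B p.2.1.toNNReal p.1 - B p.2.2.toNNReal p.1| < 2} := by
    have h1 : Measurable fun p : Ω × ℝ × ℝ => B p.2.1.toNNReal p.1 :=
      hB.measurable_uncurry.comp (measurable_fst.prodMk (measurable_fst.comp measurable_snd))
    have h2 : Measurable fun p : Ω × ℝ × ℝ => B p.2.2.toNNReal p.1 :=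
      hB.measurable_uncurry.comp (measurable_fst.prodMk (measurable_snd.comp measurable_snd))
    exact measurableSet_lt (h1.sub h2).abs measurable_const
  have hg : Measurable g := measurable_one.indicator hset
  have hg2 : Measurable fun p => 2 * g p := hg.const_mul 2
  calc ∫⁻ ω, ENNReal.ofReal (∫ z : ℝ, occupationTime B T ω z ^ 2) ∂Q
      ≤ ∫⁻ ω, (∫⁻ s in Set.Icc 0 T, ∫⁻ t in Set.Icc 0 T, 2 * g (ω, s, t)) ∂Q := by
        refine lintegral_mono fun ω => ?_
        have hc := hB.continuous_real_path ω
        rw [ofReal_selfIntersection hc hT]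
        exact lintegral_occ_sq_le hc T
    _ = ∫⁻ s in Set.Icc 0 T, ∫⁻ t in Set.Icc 0 T, ∫⁻ ω, 2 * g (ω, s, t) ∂Q := by
        have hm : Measurable fun p : (Ω × ℝ) × ℝ => 2 * g (p.1.1, p.1.2, p.2) :=
          hg2.comp ((measurable_fst.comp measurable_fst).prodMk
            ((measurable_snd.comp measurable_fst).prodMk measurable_snd))
        rw [lintegral_lintegral_swap
          (f := fun ω s => ∫⁻ t in Set.Icc 0 T, 2 * g (ω, s, t))
          (Measurable.aemeasurable (Measurable.lintegral_prod_right' hm))]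
        refine lintegral_congr fun s => ?_
        exact lintegral_lintegral_swap (f := fun ω t => 2 * g (ω, s, t))
          (hg2.comp (measurable_fst.prodMk (measurable_const.prodMk measurable_snd))).aemeasurable
    _ ≤ ∫⁻ s in Set.Icc 0 T, (2 * ENNReal.ofReal A) := by
        refine setLIntegral_mono measurable_const fun s hs => ?_
        calc ∫⁻ t in Set.Icc 0 T, ∫⁻ ω, 2 * g (ω, s, t) ∂Q
            = 2 * ∫⁻ t in Set.Icc 0 T, Q {ω | |B s.toNNReal ω - B t.toNNReal ω| < 2} := by
              rw [← lintegral_const_mul' _ _ (by simp)]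
              refine lintegral_congr fun t => ?_
              rw [lintegral_const_mul' _ _ (by simp)]
              congr 1
              refine lintegral_indicator_one
                (s := {ω | |B s.toNNReal ω - B t.toNNReal ω| < 2}) ?_
              exact hset.preimage (f := fun ω => (ω, s, t))
                (measurable_id.prodMk measurable_const)
          _ ≤ 2 * ∫⁻ t in Set.Icc 0 T, κ s t := by
              gcongr 1
              exact setLIntegral_mono' measurableSet_Icc fun t ht => hκ s hs t ht
          _ ≤ 2 * ENNReal.ofReal A := by
              gcongr
              exact (setLIntegral_le_lintegral _ _).trans (hA s)
    _ ≤ ENNReal.ofReal (2 * A * T) := by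
        rw [setLIntegral_const, Real.volume_Icc, sub_zero, ENNReal.ofReal_mul' hT,
          ENNReal.ofReal_mul (by norm_num), ENNReal.ofReal_ofNat]

/-- The lower bound on the partition function that the tilt by `lam * B_T` gives. -/
lemma exp_le_partitionFunction (hH : H ∈ Set.Ioo (0 : ℝ) 1) {K : ℝ} (hK : 0 < K)
    (hKint : ∀ v : ℝ, 0 < v → ∀ s : ℝ,
      ∫⁻ t : ℝ, ((Set.Iio (4 / v)).indicator 1 |t - s| + ENNReal.ofReal
        (4 * (|t - s| ^ (-H) * Real.exp (-(v ^ 2 / 8) * |t - s| ^ (2 - 2 * H))))) ≤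
        ENNReal.ofReal (K / v)) {β : ℝ} (hβ : 0 < β) (hT : 0 < T) {lam : ℝ} (hlam : 0 < lam) :
    Real.exp (-(β * (2 * (K / (lam * (H / 2) * T ^ (2 * H - 1))) * T)) -
      lam ^ 2 * T ^ (2 * H) / 2) ≤ partitionFunction β B P T := by
  have hP : IsProbabilityMeasure P := hB.isGaussianProcess.isProbabilityMeasure
  obtain ⟨hH0, hH1⟩ := hH
  set v : ℝ := lam * (H / 2) * T ^ (2 * H - 1) with hv
  have hv0 : 0 < v := by positivity
  set Q := P.tilted fun ω => lam * B T.toNNReal ω with hQ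
  have hle := hB.lintegral_selfIntersection_le (Q := Q) (T := T) hT.le
    (fun s hs t ht => hB.tilted_increment_le' ⟨hH0, hH1⟩ hT hlam hs ht)
    (fun s => hKint v hv0 s)
  set F : Ω → ℝ := fun ω => ∫ z : ℝ, occupationTime B T ω z ^ 2 with hF
  have hF0 : ∀ ω, 0 ≤ F ω := fun ω => integral_nonneg fun z => sq_nonneg _
  have hFm : Measurable F := hB.measurable_selfIntersection T
  have hFint : Integrable F Q := by
    refine (lintegral_ofReal_ne_top_iff_integrable hFm.aestronglyMeasurable
      (Filter.Eventually.of_forall hF0)).1 ?_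
    exact (hle.trans_lt ENNReal.ofReal_lt_top).ne
  have hFle : ∫ ω, F ω ∂Q ≤ 2 * (K / v) * T := by
    rw [integral_eq_lintegral_of_nonneg_ae (Filter.Eventually.of_forall hF0)
      hFm.aestronglyMeasurable]
    exact ENNReal.toReal_le_of_le_ofReal (by positivity) hle
  have hξ : HasGaussianLaw (fun ω => lam * B T.toNNReal ω) P :=
    (hB.hasGaussianLaw_increment_endpoint 0 0 T.toNNReal lam).snd
  have hξ0 : ∫ ω, lam * B T.toNNReal ω ∂P = 0 := by
    rw [integral_const_mul, hB.mean_zero, mul_zero]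
  have hξ2 : ∫ ω, (lam * B T.toNNReal ω) ^ 2 ∂P = lam ^ 2 * T ^ (2 * H) := by
    simp_rw [mul_pow]
    rw [integral_const_mul, hB.integral_sq hH0, Real.coe_toNNReal _ hT.le]
  have hexp : Integrable (fun ω => Real.exp (-(β * F ω))) P := by
    refine Integrable.of_bound ((hFm.const_mul β).neg.exp.aestronglyMeasurable) 1
      (Filter.Eventually.of_forall fun ω => ?_)
    rw [Real.norm_of_nonneg (Real.exp_pos _).le]
    have := mul_nonneg hβ.le (hF0 ω)
    exact Real.exp_le_one_iff.2 (by linarith)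
  have hJ := exp_le_integral_exp_neg hξ hξ0 (hFint.const_mul β) hexp
  rw [integral_const_mul, hξ2] at hJ
  have hZ : partitionFunction β B P T = ∫ ω, Real.exp (-(β * F ω)) ∂P := by
    simp only [partitionFunction, weight, neg_mul, hF]
  rw [hZ]
  refine (Real.exp_le_exp.2 ?_).trans hJ
  have := mul_le_mul_of_nonneg_left hFle hβ.le
  linarith

end IsRegularFBM

/-- Lower bound on the partition function at the Flory scale. -/
theorem exists_exp_le_partitionFunction (hH : H ∈ Set.Ioo (0 : ℝ) 1) :
    ∃ C : ℝ, 0 < C ∧ ∀ {Ω : Type u} [MeasurableSpace Ω] {P : Measure Ω} {B : ℝ≥0 → Ω → ℝ},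
      IsRegularFBM H B P → ∀ β : ℝ, 0 < β → ∀ T : ℝ, 0 < T →
        Real.exp (-C * (β ^ (2 / 3 : ℝ) * T ^ (2 * (2 - H) / 3))) ≤ partitionFunction β B P T := by
  obtain ⟨K, hK, hKint⟩ := exists_lintegral_hitting_bound_le hH
  have hH0 : 0 < H := hH.1
  refine ⟨4 * K / H + 1 / 2, by positivity, fun {Ω} _ P B hB β hβ T hT => ?_⟩
  -- The energy is of order `β T^(2-2H) / lam` and the entropy is `lam² T^(2H) / 2`. They balance at
  -- `lam³ = β T^(2-4H)`, contributing `4K/H` and `1/2` to the constant.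
  set lam : ℝ := β ^ (1 / 3 : ℝ) * T ^ ((2 - 4 * H) / 3) with hlam
  have hlam0 : 0 < lam := by positivity
  refine le_trans (le_of_eq ?_) (hB.exp_le_partitionFunction hH hK hKint hβ hT hlam0)
  congr 1
  set X : ℝ := β ^ (2 / 3 : ℝ) * T ^ (2 * (2 - H) / 3) with hX
  have e1 : lam ^ 2 * T ^ (2 * H) = X := by
    rw [hlam, mul_pow, ← Real.rpow_mul_natCast hβ.le, ← Real.rpow_mul_natCast hT.le, mul_assoc,
      ← Real.rpow_add hT]
    congr 2 <;> push_cast <;> ring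
  have e2 : β * T = X * (lam * T ^ (2 * H - 1)) := by
    have : X * (lam * T ^ (2 * H - 1)) = (β ^ (2 / 3 : ℝ) * β ^ (1 / 3 : ℝ)) *
        (T ^ (2 * (2 - H) / 3) * T ^ ((2 - 4 * H) / 3) * T ^ (2 * H - 1)) := by
      rw [hX, hlam]; ring
    rw [this, ← Real.rpow_add hβ, ← Real.rpow_add hT, ← Real.rpow_add hT]
    have h1 : (2 / 3 + 1 / 3 : ℝ) = 1 := by norm_num
    have h2 : 2 * (2 - H) / 3 + (2 - 4 * H) / 3 + (2 * H - 1) = 1 := by ring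
    rw [h1, h2, Real.rpow_one, Real.rpow_one]
  have hTp : 0 < T ^ (2 * H - 1) := by positivity
  have e3 : β * (2 * (K / (lam * (H / 2) * T ^ (2 * H - 1))) * T) = 4 * K / H * X := by
    have : β * (2 * (K / (lam * (H / 2) * T ^ (2 * H - 1))) * T) =
        (β * T) * (4 * K / H) / (lam * T ^ (2 * H - 1)) := by
      field_simp
      norm_num
    rw [this, e2]
    field_simp
  rw [e1, e3]
  ring

end SelfRepellent

/-! ### Concentration of the radius under the self-repellent measure -/

namespace SelfRepellent

open Filter
open scoped ENNReal

section

variable {Ω : Type*} {H : ℝ} {B : ℝ≥0 → Ω → ℝ} {T : ℝ}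

/-- A small radius of gyration forces a small weight. -/
lemma weight_le_of_radius_le {ω : Ω} (hc : Continuous fun t : ℝ => B t.toNNReal ω) {β : ℝ}
    (hβ : 0 ≤ β) (hT : 0 < T) {ρ : ℝ} (hρ : 1 ≤ ρ) (hR : radius B T ω ≤ ρ) :
    weight β B T ω ≤ Real.exp (-(β * (3 * T ^ 2 / (8 * ρ)))) := by
  have hsq : radius B T ω ^ 2 ≤ ρ ^ 2 := pow_le_pow_left₀ (radius_nonneg B T ω) hR 2
  rw [radius_sq_eq hT, one_div, inv_mul_le_iff₀ hT] at hsq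
  have := mul_le_mul_of_nonneg_left (le_integral_occ_sq hc hT hρ hsq) hβ
  refine Real.exp_le_exp.2 ?_
  simp only [occupationTime_eq_occ]
  linarith

variable [MeasurableSpace Ω] {P : Measure Ω}

namespace IsRegularFBM

variable (hB : IsRegularFBM H B P)
include hB

lemma integrable_weight {β : ℝ} (hβ : 0 ≤ β) (T : ℝ) : Integrable (weight β B T) P := by
  have hP : IsProbabilityMeasure P := hB.isGaussianProcess.isProbabilityMeasure
  refine Integrable.of_bound (hB.measurable_weight β T).aestronglyMeasurable 1
    (Eventually.of_forall fun ω => ?_)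
  rw [Real.norm_of_nonneg (weight_nonneg β B T ω)]
  exact weight_le_one hβ B T ω

lemma selfRepellentMeasure_real_apply {β : ℝ} (hβ : 0 ≤ β) (T : ℝ) {S : Set Ω}
    (hS : MeasurableSet S) :
    (selfRepellentMeasure β B P T).real S =
      (∫ ω in S, weight β B T ω ∂P) / partitionFunction β B P T := by
  have hZ : 0 ≤ partitionFunction β B P T := integral_nonneg fun ω => weight_nonneg β B T ω
  rw [measureReal_def, selfRepellentMeasure, withDensity_apply _ hS,
    ← ofReal_integral_eq_lintegral_ofReal ((hB.integrable_weight hβ T).div_const _).integrableOn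
      (Eventually.of_forall fun ω => div_nonneg (weight_nonneg β B T ω) hZ),
    integral_div, ENNReal.toReal_ofReal]
  exact div_nonneg (integral_nonneg fun ω => weight_nonneg β B T ω) hZ

lemma setIntegral_weight_le_of_radius_lt {β : ℝ} (hβ : 0 ≤ β) (hT : 0 < T) {ρ : ℝ}
    (hρ : 1 ≤ ρ) :
    ∫ ω in {ω | radius B T ω < ρ}, weight β B T ω ∂P ≤
      Real.exp (-(β * (3 * T ^ 2 / (8 * ρ)))) := by
  have hP : IsProbabilityMeasure P := hB.isGaussianProcess.isProbabilityMeasure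
  calc ∫ ω in {ω | radius B T ω < ρ}, weight β B T ω ∂P
      ≤ ∫ ω in {ω | radius B T ω < ρ}, Real.exp (-(β * (3 * T ^ 2 / (8 * ρ)))) ∂P :=
        setIntegral_mono_on (hB.integrable_weight hβ T).integrableOn (integrable_const _)
          (measurableSet_lt (hB.measurable_radius T) measurable_const) fun ω hω =>
          weight_le_of_radius_le (hB.continuous_real_path ω) hβ hT hρ (le_of_lt hω)
    _ = P.real {ω | radius B T ω < ρ} * Real.exp (-(β * (3 * T ^ 2 / (8 * ρ)))) := by
        rw [setIntegral_const, smul_eq_mul]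
    _ ≤ _ := mul_le_of_le_one_left (Real.exp_pos _).le measureReal_le_one

/-- Concentration of the radius of gyration, given a lower bound on the partition function and
the two tail bounds. -/
lemma one_sub_le_selfRepellentMeasure {β : ℝ} (hβ : 0 ≤ β) {lo hi Y : ℝ}
    (hZ : Real.exp (-Y) ≤ partitionFunction β B P T)
    (hlo : ∫ ω in {ω | radius B T ω < lo}, weight β B T ω ∂P ≤ Real.exp (-(2 * Y)))
    (hhi : ∫ ω in {ω | hi ≤ radius B T ω}, weight β B T ω ∂P ≤ Real.exp (-(2 * Y))) :
    1 - 2 * Real.exp (-Y) ≤ (selfRepellentMeasure β B P T).real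
      {ω | lo ≤ radius B T ω ∧ radius B T ω ≤ hi} := by
  have hw := hB.integrable_weight hβ T
  have hR := hB.measurable_radius T
  have hnn : ∀ (s : Set Ω), 0 ≤ᵐ[P.restrict s] weight β B T := fun s =>
    Eventually.of_forall fun ω => weight_nonneg β B T ω
  set S : Set Ω := {ω | lo ≤ radius B T ω ∧ radius B T ω ≤ hi} with hSdef
  have hS : MeasurableSet S :=
    (measurableSet_le measurable_const hR).inter (measurableSet_le hR measurable_const)
  have hZ0 : 0 < partitionFunction β B P T := (Real.exp_pos _).trans_le hZ
  have hcompl : ∫ ω in Sᶜ, weight β B T ω ∂P ≤ 2 * Real.exp (-(2 * Y)) := by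
    calc ∫ ω in Sᶜ, weight β B T ω ∂P
        ≤ ∫ ω in {ω | radius B T ω < lo} ∪ {ω | hi ≤ radius B T ω}, weight β B T ω ∂P := by
          refine setIntegral_mono_set hw.integrableOn (hnn _) (LE.le.eventuallyLE ?_)
          intro ω hω
          by_contra h
          simp only [Set.mem_union, Set.mem_ofPred_eq, not_or, not_lt, not_le] at h
          exact hω ⟨h.1, h.2.le⟩
      _ ≤ (∫ ω in {ω | radius B T ω < lo}, weight β B T ω ∂P) +
            ∫ ω in {ω | hi ≤ radius B T ω}, weight β B T ω ∂P := by
          have h := integral_mono_measure (Measure.restrict_union_le (μ := P)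
            {ω | radius B T ω < lo} {ω | hi ≤ radius B T ω})
            (f := weight β B T) (Eventually.of_forall fun ω => weight_nonneg β B T ω)
            (Integrable.add_measure hw.integrableOn hw.integrableOn)
          rwa [integral_add_measure hw.integrableOn hw.integrableOn] at h
      _ ≤ 2 * Real.exp (-(2 * Y)) := by linarith
  have hsplit : (∫ ω in S, weight β B T ω ∂P) + ∫ ω in Sᶜ, weight β B T ω ∂P =
      partitionFunction β B P T := integral_add_compl hS hw
  rw [hB.selfRepellentMeasure_real_apply hβ T hS, le_div_iff₀ hZ0]
  -- One factor `exp(-Y)` of the tail bound is absorbed by the partition function, the other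
  -- survives as the error.
  have hmul : Real.exp (-(2 * Y)) ≤ Real.exp (-Y) * partitionFunction β B P T := by
    calc Real.exp (-(2 * Y)) = Real.exp (-Y) * Real.exp (-Y) := by
          rw [← Real.exp_add]; congr 1; ring
      _ ≤ _ := mul_le_mul_of_nonneg_left hZ (Real.exp_pos _).le
  linarith

end IsRegularFBM

lemma selfRepellentMeasure_congr {B' : ℝ≥0 → Ω → ℝ} (h : ∀ᵐ ω ∂P, ∀ t, B t ω = B' t ω)
    (β T : ℝ) :
    partitionFunction β B P T = partitionFunction β B' P T ∧
      selfRepellentMeasure β B P T = selfRepellentMeasure β B' P T := by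
  have hZ : partitionFunction β B P T = partitionFunction β B' P T :=
    integral_congr_ae (h.mono fun ω hω => weight_congr hω β T)
  refine ⟨hZ, withDensity_congr_ae (h.mono fun ω hω => ?_)⟩
  simp only [hZ, weight_congr hω]

lemma selfRepellentMeasure_real_congr {B' : ℝ≥0 → Ω → ℝ} (h : ∀ᵐ ω ∂P, ∀ t, B t ω = B' t ω)
    (β T : ℝ) (p : ℝ → Prop) :
    (selfRepellentMeasure β B P T).real {ω | p (radius B T ω)} =
      (selfRepellentMeasure β B' P T).real {ω | p (radius B' T ω)} := by
  rw [(selfRepellentMeasure_congr h β T).2]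
  refine measureReal_congr ?_
  have hac : selfRepellentMeasure β B' P T ≪ P := withDensity_absolutelyContinuous _ _
  filter_upwards [hac.ae_le h] with ω hω
  exact congrArg p (radius_congr hω T)

lemma setIntegral_weight_congr {B' : ℝ≥0 → Ω → ℝ} (h : ∀ᵐ ω ∂P, ∀ t, B t ω = B' t ω)
    (β T : ℝ) (p : ℝ → Prop) :
    ∫ ω in {ω | p (radius B T ω)}, weight β B T ω ∂P =
      ∫ ω in {ω | p (radius B' T ω)}, weight β B' T ω ∂P := by
  have hset : {ω | p (radius B T ω)} =ᵐ[P] {ω | p (radius B' T ω)} := by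
    filter_upwards [h] with ω hω
    exact congrArg p (radius_congr hω T)
  rw [setIntegral_congr_set hset]
  exact integral_congr_ae (ae_restrict_of_ae (h.mono fun ω hω => weight_congr hω β T))

end

/-! ### Powers of `β` and `T` at the Flory scale -/

section Scaling

variable {H β T : ℝ}

lemma eventually_le_mul_rpow {c p : ℝ} (hc : 0 < c) (hp : 0 < p) (a : ℝ) :
    ∀ᶠ T : ℝ in atTop, a ≤ c * T ^ p :=
  ((tendsto_rpow_atTop hp).const_mul_atTop hc).eventually_ge_atTop a

lemma eventually_rpow_le_mul_rpow {c p q : ℝ} (hc : 0 < c) (hpq : q < p) :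
    ∀ᶠ T : ℝ in atTop, T ^ q ≤ c * T ^ p := by
  filter_upwards [eventually_le_mul_rpow hc (sub_pos.2 hpq) 1, eventually_gt_atTop 0] with T h hT
  rw [Real.rpow_sub hT, ← mul_div_assoc, one_le_div (by positivity)] at h
  exact h

lemma mul_sq_div_flory_radius (hβ : 0 < β) (hT : 0 < T) {c : ℝ} (hc : 0 < c) :
    β * (3 * T ^ 2 / (8 * (c * β ^ (1 / 3 : ℝ) * T ^ (2 * (1 + H) / 3)))) =
      3 / (8 * c) * (β ^ (2 / 3 : ℝ) * T ^ (2 * (2 - H) / 3)) := by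
  have h1 : β ^ (2 / 3 : ℝ) * β ^ (1 / 3 : ℝ) = β := by
    rw [← Real.rpow_add hβ]; norm_num
  have h2 : T ^ (2 * (2 - H) / 3) * T ^ (2 * (1 + H) / 3) = T ^ 2 := by
    rw [← Real.rpow_add hT, ← Real.rpow_two]; congr 1; ring
  have hb : β ^ (1 / 3 : ℝ) ≠ 0 := by positivity
  have ht : T ^ (2 * (1 + H) / 3) ≠ 0 := by positivity
  have e : 3 / (8 * c) * (β ^ (2 / 3 : ℝ) * T ^ (2 * (2 - H) / 3)) =
      3 / (8 * c) * ((β ^ (2 / 3 : ℝ) * β ^ (1 / 3 : ℝ)) *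
        (T ^ (2 * (2 - H) / 3) * T ^ (2 * (1 + H) / 3))) /
          (β ^ (1 / 3 : ℝ) * T ^ (2 * (1 + H) / 3)) := by
    field_simp
  rw [e, h1, h2]
  field_simp

lemma flory_radius_sq_div (hβ : 0 < β) (hT : 0 < T) (c : ℝ) :
    (c * β ^ (1 / 3 : ℝ) * T ^ (2 * (1 + H) / 3)) ^ 2 / T ^ (2 * H) =
      c ^ 2 * (β ^ (2 / 3 : ℝ) * T ^ (2 * (2 - H) / 3)) := by
  rw [mul_pow, mul_pow, ← Real.rpow_mul_natCast hβ.le, ← Real.rpow_mul_natCast hT.le, mul_div_assoc,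
    ← Real.rpow_sub hT, mul_assoc]
  congr 3 <;> push_cast <;> ring

end Scaling

end SelfRepellent

/-! ### The main theorem -/

theorem theorem1p1 (H : ℝ) (hH : H ∈ Set.Ioo (0 : ℝ) 1) :
    ∃ Clow Cup C C' : ℝ, 0 < Clow ∧ 0 < Cup ∧ 0 < C ∧ 0 < C' ∧
      Clow = (9 / 128) / (2 * C) ∧
      Cup = Real.sqrt (2 * C / C') ∧
      (∀ (Ω : Type u) [MeasurableSpace Ω] (P : Measure Ω) [IsProbabilityMeasure P]
        (B : ℝ≥0 → Ω → ℝ), SelfRepellent.IsFBM H B P →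
        ∀ β : ℝ, 0 < β → ∀ T : ℝ, 0 < T → ∀ r : ℝ, T ^ H ≤ r →
          ∫ ω in {ω | r ≤ SelfRepellent.radius B T ω}, SelfRepellent.weight β B T ω ∂P
            ≤ Real.exp (-C' * (r ^ 2 / T ^ (2 * H)))) ∧
      ∀ β : ℝ, 0 < β → ∃ Tβ : ℝ, Real.exp 1 ≤ Tβ ∧
        ∀ (Ω : Type u) [MeasurableSpace Ω] (P : Measure Ω) [IsProbabilityMeasure P]
          (B : ℝ≥0 → Ω → ℝ), SelfRepellent.IsFBM H B P →
          ∀ T : ℝ, Tβ ≤ T →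
            -C * β ^ (2 / 3 : ℝ) * T ^ (2 * (2 - H) / 3)
                ≤ Real.log (SelfRepellent.partitionFunction β B P T) ∧
            1 - 2 * Real.exp (-C * β ^ (2 / 3 : ℝ) * T ^ (2 * (2 - H) / 3))
              ≤ (SelfRepellent.selfRepellentMeasure β B P T).real
                {ω | Clow * β ^ (1 / 3 : ℝ) * T ^ (2 * (1 + H) / 3)
                      ≤ SelfRepellent.radius B T ω ∧
                  SelfRepellent.radius B T ω
                      ≤ Cup * β ^ (1 / 3 : ℝ) * T ^ (2 * (1 + H) / 3)} := by
  obtain ⟨C, hC, hZ⟩ := SelfRepellent.exists_exp_le_partitionFunction.{u} hH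
  have hH0 : 0 < H := hH.1
  have hH1 : H < 1 := hH.2
  set C' : ℝ := (1 - 1 / (2 * H + 1)) ^ 2 / 16 with hC'def
  have hC' : 0 < C' := by
    have : 1 / (2 * H + 1) < 1 := by
      rw [div_lt_one (by positivity)]
      linarith
    have : 0 < 1 - 1 / (2 * H + 1) := by linarith
    positivity
  refine ⟨(9 / 128) / (2 * C), √(2 * C / C'), C, C', by positivity, by positivity, hC, hC', rfl,
    rfl, ?_, ?_⟩
  · intro Ω _ P _ B hB β hβ T hT r hr
    obtain ⟨B', hB', h⟩ := hB.exists_regular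
    rw [SelfRepellent.setIntegral_weight_congr h β T fun x => r ≤ x]
    exact hB'.setIntegral_weight_le hH0 hβ.le hT hr
  · intro β hβ
    have hlo : 0 < (9 / 128) / (2 * C) * β ^ (1 / 3 : ℝ) := by positivity
    have hhi : 0 < √(2 * C / C') * β ^ (1 / 3 : ℝ) := by positivity
    -- For large `T` the lower radius is at least 1, as the occupation bound requires, and the upper
    -- radius is at least `T^H`, as the tail bound requires. The latter holds because `H <
    -- 2(1+H)/3`. The threshold is fixed before the process is introduced.
    obtain ⟨T₀, hT₀⟩ := Filter.eventually_atTop.1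
      ((SelfRepellent.eventually_le_mul_rpow hlo (p := 2 * (1 + H) / 3) (by positivity) 1).and
        (SelfRepellent.eventually_rpow_le_mul_rpow hhi (p := 2 * (1 + H) / 3) (q := H)
          (by linarith)))
    refine ⟨max (Real.exp 1) T₀, le_max_left _ _, fun Ω _ P _ B hB T hTle => ?_⟩
    have hT : 0 < T := (Real.exp_pos 1).trans_le ((le_max_left _ _).trans hTle)
    obtain ⟨hlo1, hhi1⟩ := hT₀ T ((le_max_right _ _).trans hTle)
    obtain ⟨B', hB', h⟩ := hB.exists_regular
    have hZ' := hZ hB' β hβ T hT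
    set X : ℝ := β ^ (2 / 3 : ℝ) * T ^ (2 * (2 - H) / 3) with hX
    have hX0 : 0 < X := by positivity
    have hCX : -C * β ^ (2 / 3 : ℝ) * T ^ (2 * (2 - H) / 3) = -(C * X) := by rw [hX]; ring
    rw [neg_mul] at hZ'
    rw [hCX, (SelfRepellent.selfRepellentMeasure_congr h β T).1,
      SelfRepellent.selfRepellentMeasure_real_congr h β T fun x =>
        (9 / 128) / (2 * C) * β ^ (1 / 3 : ℝ) * T ^ (2 * (1 + H) / 3) ≤ x ∧
          x ≤ √(2 * C / C') * β ^ (1 / 3 : ℝ) * T ^ (2 * (1 + H) / 3)]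
    refine ⟨(Real.le_log_iff_exp_le ((Real.exp_pos _).trans_le hZ')).2 hZ', ?_⟩
    refine hB'.one_sub_le_selfRepellentMeasure hβ.le hZ' ?_ ?_
    · refine (hB'.setIntegral_weight_le_of_radius_lt hβ.le hT hlo1).trans (Real.exp_le_exp.2 ?_)
      rw [SelfRepellent.mul_sq_div_flory_radius hβ hT (by positivity), ← hX, neg_le_neg_iff]
      -- Only a coefficient of at least `2 * C` is needed, so the constant `9/128` leaves room.
      have e : 3 / (8 * ((9 / 128) / (2 * C))) = 32 / 3 * C := by
        field_simp
        norm_num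
      rw [e]
      nlinarith [mul_pos hC hX0]
    · refine (hB'.setIntegral_weight_le hH0 hβ.le hT hhi1).trans (Real.exp_le_exp.2 ?_)
      -- Here there is no slack: `C'` times the squared upper constant is exactly `2 * C`.
      rw [SelfRepellent.flory_radius_sq_div hβ hT, ← hX, ← hC'def, Real.sq_sqrt (by positivity)]
      refine le_of_eq ?_
      field_simp
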